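/- Let $n\ge 6$ and let $\mathrm L_n\subset \mathrm{Hom}(\wedge^2\mathbb C^n,\mathbb C^n)$ be the variety of Lie brackets on $\mathbb C^n$. The group $\mathrm{GL}_n(\mathbb C)$ acts by $(g\cdot\mu)(x,y)=g\,\mu(g^{-1}x,g^{-1}y)$, and $\mathcal O(\mu)$ is the orbit (isomorphism class) of $\mu$. A bracket $\mu'$ \emph{degenerates} to $\mu$ if $\mu\in\overline{\mathcal O(\mu')}\setminus\mathcal O(\mu')$ (Zariski closure). A \emph{linear deformation} of $\mu\in \mathrm L_n$ is a family $\mu_t=\mu+t\varphi$, $t\in\mathbb C\setminus\{0\}$, with $\varphi\in\mathrm L_n$ and all $\mu_t\in \mathrm L_n$. Let $H$ be a separable complex Hilbert space, $N_0$ an unbounded self-adjoint operator on $H$, $\mathcal D=\bigcap_{k\ge0}D(N_0^k)$, and let $\mathcal L^\dagger(\mathcal D)$ be the algebra of operators which, together with their adjoints, map $\mathcal D$ into itself, with the commutator as Lie bracket. \emph{Pseudobosonic operators} are finitely many pairs $A_i,B_i\in\mathcal L^\dagger(\mathcal D)$ with $A_iB_jf-B_jA_if=\delta_{ij}f$ for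 $f\in\mathcal D$, the $A_i$ commuting with each other and the $B_i$ commuting with each other, such that there are nonzero $\varphi_0,\Psi_0\in\mathcal D$ with $A_i\varphi_0=0$ and $B_i^\dagger\Psi_0=0$ for all $i$, and such that the vectors $\prod_i (k_i!)^{-1/2}B_i^{k_i}\varphi_0$ form an (unconditional) basis of $H$. A Lie algebra is \emph{realized by pseudobosonic operators} if it is isomorphic to a Lie subalgebra of some $\mathcal L^\dagger(\mathcal D)$ that consists of elements of the associative algebra generated by such $A_i,B_i,A_i^\dagger,B_i^\dagger$ and the identity, and that contains at least one of the pairs $A_i,B_i$. Let $\mu\in\mathrm L_n$ be such that $\mathfrak g=(\mathbb C^n,\mu)$ is nilpotent and has a nonzero semisimple (i.e. diagonalizable) derivation. Then: (1) there is a linear deformation $\mu_t=\mu+t\psi$ of $\mu$ such that, for every $t\ne0$, $\mu_t$ degenerates to $\mu$ (so $\mathfrak g$ is the degeneration of another Lie algebra); (2) there is a Lie bracket $\nu\in\mathrm L_n$ such that $(\mathbb C^n,\nu)$ is nilpotent, is not isomorphic to $\mathfrak g$ and is realized by pseudobosonic operators, and $\mathfrak g$ is obtained from it by a linear deformation: there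 is a linear deformation $\nu_t=\nu+t\varphi$ of $\nu$ with $\mu=\nu_t$ for some $t\neq 0$. -/

import Mathlib

noncomputable section

namespace PB

/-! ### Lie brackets on `ℂⁿ`, orbits, degenerations, linear deformations -/

/-- Bilinear maps `ℂⁿ × ℂⁿ → ℂⁿ`. -/
abbrev Bil (n : ℕ) : Type :=
  (Fin n → ℂ) →ₗ[ℂ] (Fin n → ℂ) →ₗ[ℂ] (Fin n → ℂ)

/-- Alternating bilinear maps satisfying the Jacobi identity. -/
structure IsLieBracket {n : ℕ} (μ : Bil n) : Prop where
  alternating : ∀ x, μ x x = 0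
  jacobi : ∀ x y z, μ x (μ y z) + μ y (μ z x) + μ z (μ x y) = 0

theorem leibniz {n : ℕ} {μ : Bil n} (h : IsLieBracket μ) (x y z : Fin n → ℂ) :
    μ x (μ y z) = μ (μ x y) z + μ y (μ x z) := by
  have skew : ∀ a b, μ a b = - μ b a := by
    intro a b
    have h' := h.alternating (a + b)
    simp only [map_add, LinearMap.add_apply, h.alternating, zero_add, add_zero] at h'
    exact eq_neg_of_add_eq_zero_right h'
  have hj := h.jacobi x y z
  rw [skew z x, map_neg, skew z (μ x y), add_assoc, add_eq_zero_iff_eq_neg] at hj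
  rw [hj]
  abel

/-- The variety `Lₙ` of Lie brackets on `ℂⁿ`. -/
def lieVariety (n : ℕ) : Set (Bil n) := {μ | IsLieBracket μ}

/-- The Lie algebra `(ℂⁿ, μ)`. -/
def LieAlg {n : ℕ} (_μ : lieVariety n) : Type := Fin n → ℂ

namespace LieAlg

variable {n : ℕ} (μ : lieVariety n)

instance : AddCommGroup (LieAlg μ) := inferInstanceAs (AddCommGroup (Fin n → ℂ))

instance : Module ℂ (LieAlg μ) := inferInstanceAs (Module ℂ (Fin n → ℂ))

instance : LieRing (LieAlg μ) where
  bracket x y := (μ : Bil n) x y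
  add_lie x y z := LinearMap.map_add₂ (μ : Bil n) x y z
  lie_add x y z := map_add ((μ : Bil n) x) y z
  lie_self x := μ.2.alternating x
  leibniz_lie x y z := leibniz μ.2 x y z

instance : LieAlgebra ℂ (LieAlg μ) where
  lie_smul c x y := map_smul ((μ : Bil n) x) c y

end LieAlg

/-- The action of `GLₙ(ℂ)`: `(g • μ)(x, y) = g (μ (g⁻¹ x, g⁻¹ y))`. -/
def act {n : ℕ} (g : (Fin n → ℂ) ≃ₗ[ℂ] (Fin n → ℂ)) (μ : Bil n) : Bil n :=
  (μ.compl₁₂ g.symm.toLinearMap g.symm.toLinearMap).compr₂ g.toLinearMap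

/-- The orbit of `μ`, that is, its isomorphism class. -/
def orbit {n : ℕ} (μ : Bil n) : Set (Bil n) := {ν | ∃ g, ν = act g μ}

/-- The coordinates (structure constants) of a bilinear map. -/
def structureConstants {n : ℕ} (μ : Bil n) : Fin n × Fin n × Fin n → ℂ :=
  fun p => μ (Pi.single p.1 1) (Pi.single p.2.1 1) p.2.2

/-- Zariski closure: the common zeros of all polynomials in the coordinates vanishing on `S`. -/
def zariskiClosure {n : ℕ} (S : Set (Bil n)) : Set (Bil n) :=
  {ν | ∀ p : MvPolynomial (Fin n × Fin n × Fin n) ℂ,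
    (∀ μ ∈ S, MvPolynomial.eval (structureConstants μ) p = 0) →
      MvPolynomial.eval (structureConstants ν) p = 0}

/-- `μ` degenerates to `ν`: `ν` lies in the Zariski closure of the orbit of `μ`,
but not in the orbit itself. -/
def DegeneratesTo {n : ℕ} (μ ν : Bil n) : Prop :=
  ν ∈ zariskiClosure (orbit μ) \ orbit μ

/-- `μ_t = μ + t φ`, `t ≠ 0`, is a linear deformation of the Lie bracket `μ`. -/
structure IsLinearDeformation {n : ℕ} (μ φ : Bil n) : Prop where
  base : μ ∈ lieVariety n
  direction : φ ∈ lieVariety n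
  family : ∀ t : ℂ, t ≠ 0 → μ + t • φ ∈ lieVariety n

/-- A nonzero derivation that is semisimple (over `ℂ`: diagonalizable) as a linear map. -/
def HasNontrivialSemisimpleDerivation (L : Type*) [LieRing L] [LieAlgebra ℂ L] : Prop :=
  ∃ D : LieDerivation ℂ L L, D ≠ 0 ∧ Module.End.IsSemisimple (D : L →ₗ[ℂ] L)

/-! ### Pseudobosonic operators -/

section Operators

variable {H : Type*} [NormedAddCommGroup H] [InnerProductSpace ℂ H]

/-- The domain of `T ^ k` for an unbounded operator `T`. -/
def powDomain (T : H →ₗ.[ℂ] H) : ℕ → Submodule ℂ H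
  | 0 => ⊤
  | k + 1 => ((powDomain T k).comap T.toFun).map T.domain.subtype

/-- `D^∞(T)`, the intersection of the domains of all powers of `T`. -/
def smoothDomain (T : H →ₗ.[ℂ] H) : Submodule ℂ H := ⨅ k, powDomain T k

/-- `Y` is the restriction to `𝒟` of the adjoint of `X`. For dense `𝒟` there is at most one
such `Y`; it exists exactly when `𝒟 ⊆ D(X*)` and `X* 𝒟 ⊆ 𝒟`. -/
def IsDagger {𝒟 : Submodule ℂ H} (X Y : Module.End ℂ 𝒟) : Prop :=
  ∀ f g : 𝒟, inner ℂ ((X f : 𝒟) : H) (g : H) = inner ℂ (f : H) ((Y g : 𝒟) : H)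

/-- `ℒ†(𝒟)`: the operators on `𝒟` that, together with their adjoints, map `𝒟` into itself.
For dense `𝒟` such operators are closable, their adjoint being densely defined. The Lie bracket
is the commutator. -/
def Ldagger (𝒟 : Submodule ℂ H) : Subalgebra ℂ (Module.End ℂ 𝒟) where
  carrier := {X | ∃ Y, IsDagger X Y}
  mul_mem' := by
    rintro X X' ⟨Y, hY⟩ ⟨Y', hY'⟩
    exact ⟨Y' * Y, fun f g => (hY (X' f) g).trans (hY' f (Y g))⟩
  add_mem' := by
    rintro X X' ⟨Y, hY⟩ ⟨Y', hY'⟩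
    refine ⟨Y + Y', fun f g => ?_⟩
    simp only [LinearMap.add_apply, Submodule.coe_add, inner_add_left, inner_add_right,
      hY f g, hY' f g]
  algebraMap_mem' c := by
    refine ⟨algebraMap ℂ _ (starRingEnd ℂ c), fun f g => ?_⟩
    simp [Module.algebraMap_end_apply, mul_comm]

end Operators

/-- Finitely many independent pairs `(A i, B i)` of `𝒟`-pseudobosonic operators on `H`, where
`𝒟 = D^∞(N₀)` for an unbounded self-adjoint operator `N₀`; `Ad i`, `Bd i` are the adjoints of
`A i`, `B i` on `𝒟`. For `N = 1` this is a single pair with `A B f - B A f = f` on `𝒟`. -/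
structure Pseudobosons (N : ℕ) (H : Type*) [NormedAddCommGroup H] [InnerProductSpace ℂ H]
    [CompleteSpace H] where
  N₀ : H →ₗ.[ℂ] H
  selfAdjoint : IsSelfAdjoint N₀
  unbounded : ¬ ∃ C : ℝ, ∀ f : N₀.domain, ‖N₀ f‖ ≤ C * ‖f‖
  A : Fin N → Module.End ℂ (smoothDomain N₀)
  B : Fin N → Module.End ℂ (smoothDomain N₀)
  Ad : Fin N → Module.End ℂ (smoothDomain N₀)
  Bd : Fin N → Module.End ℂ (smoothDomain N₀)
  dagger_A : ∀ i, IsDagger (A i) (Ad i)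
  dagger_B : ∀ i, IsDagger (B i) (Bd i)
  ccr : ∀ i f, A i (B i f) - B i (A i f) = f
  comm_AB : ∀ i j, i ≠ j → A i * B j = B j * A i
  comm_AA : ∀ i j, A i * A j = A j * A i
  comm_BB : ∀ i j, B i * B j = B j * B i
  /-- the vacuum of the lowering operators `A i` -/
  φ₀ : smoothDomain N₀
  φ₀_ne : φ₀ ≠ 0
  A_φ₀ : ∀ i, A i φ₀ = 0
  /-- the vacuum of the lowering operators `Bd i` -/
  Ψ₀ : smoothDomain N₀
  Ψ₀_ne : Ψ₀ ≠ 0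
  Bd_Ψ₀ : ∀ i, Bd i Ψ₀ = 0
  /-- the vectors `φ_k = (∏ᵢ B i ^ kᵢ / √(kᵢ!)) φ₀` form a basis of `H` -/
  basis : ∃ b : UnconditionalSchauderBasis (Fin N → ℕ) ℂ H, ∀ k : Fin N → ℕ,
    b.basis k = ((∏ i, (Real.sqrt ((k i).factorial : ℝ) : ℂ))⁻¹ •
      (List.ofFn fun i => B i ^ k i).prod φ₀ : smoothDomain N₀)

namespace Pseudobosons

variable {N : ℕ} {H : Type*} [NormedAddCommGroup H] [InnerProductSpace ℂ H] [CompleteSpace H]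

/-- The associative algebra generated by the pseudobosonic operators and their adjoints. -/
def generatedAlgebra (P : Pseudobosons N H) :
    Subalgebra ℂ (Module.End ℂ (smoothDomain P.N₀)) :=
  Algebra.adjoin ℂ (Set.range P.A ∪ Set.range P.B ∪ Set.range P.Ad ∪ Set.range P.Bd)

end Pseudobosons

/-- `L` is realized by pseudobosonic operators: it is isomorphic, via `ρ`, to a Lie algebra of
operators in `ℒ†(𝒟)` which are built from pseudobosonic operators and among which there is a
pseudobosonic pair `A i`, `B i` (hence also the identity). -/
def RealizedByPseudobosons (L : Type*) [LieRing L] [LieAlgebra ℂ L] : Prop :=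
  ∃ (H : Type) (_ : NormedAddCommGroup H) (_ : InnerProductSpace ℂ H) (_ : CompleteSpace H)
    (_ : TopologicalSpace.SeparableSpace H) (N : ℕ) (P : Pseudobosons N H)
    (ρ : L →ₗ[ℂ] Ldagger (smoothDomain P.N₀)),
    (∀ x y, ρ ⁅x, y⁆ = ρ x * ρ y - ρ y * ρ x) ∧
    Function.Injective ρ ∧
    (∀ x, (ρ x : Module.End ℂ (smoothDomain P.N₀)) ∈ P.generatedAlgebra) ∧
    ∃ (i : Fin N) (a b : L), (ρ a : Module.End ℂ (smoothDomain P.N₀)) = P.A i ∧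
      (ρ b : Module.End ℂ (smoothDomain P.N₀)) = P.B i

end PB

end

noncomputable section

namespace PB

variable {n : ℕ}

/-! ### Brackets -/

/-! Part (1). Let `D` be a nonzero semisimple derivation. Nilpotency forces an eigenvector `X` of
`D`, with eigenvalue `l ≠ 0`, outside the derived algebra (`exists_eigenvector_notMem_derived`).
Semisimplicity then supplies a functional `f` with `f X = 1`, `f ∘ D = l f` and `f = 0` on brackets.
Take `ψ = f ∧ D`, which makes `X` act on the ideal `ker f` by `ad X + tD`. The automorphisms `exp
(cD)` of `μ` rescale `ψ` by every nonzero scalar, so all `μ + tψ` with `t ≠ 0` are isomorphic, and a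
polynomial vanishing on their orbit vanishes at `t = 0` as well. If `D ≠ 0` on `ker f`, then `ad X +
tD` has a nonzero eigenvalue there, so `μ + tψ` is not nilpotent and hence not isomorphic to `μ`. If
`D = 0` on `ker f`, then `X` is central and splits off as a direct factor. In that case `ψ = (f ∧ g)
⊗ z` makes `X` act on the other factor by a suitable derivation, and the centre shrinks strictly
(`exists_degeneration_of_central`).

Part (2). Choose independent functionals `f`, `g` vanishing on brackets and a central `z` that both
annihilate. The Heisenberg bracket `(f ∧ g) ⊗ z` is compatible with `μ`: every mixed Jacobi term
vanishes. Hence the whole pencil through the two consists of Lie brackets, and `μ` is a linear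
deformation of the Heisenberg bracket. Should `μ` itself be isomorphic to this bracket, one of rank
four with values in the same line as `μ` takes its place; this fits because `n ≥ 5`. Such a bracket
is realized on `ℓ²(ℕᴺ)` by ordinary bosons: the Heisenberg pairs become ladder operators, `z` the
identity, and the abelian remainder becomes polynomials in one additional creation operator. -/

theorem IsLieBracket.skew {μ : Bil n} (h : IsLieBracket μ) (x y : Fin n → ℂ) :
    μ x y = - μ y x := by
  have h' := h.alternating (x + y)
  simp only [map_add, LinearMap.add_apply, h.alternating, zero_add, add_zero] at h'
  exact eq_neg_of_add_eq_zero_right h'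

/-- Linear combinations of two compatible Lie brackets are Lie brackets. -/
theorem IsLieBracket.smul_add_smul {μ φ : Bil n} (hμ : IsLieBracket μ) (hφ : IsLieBracket φ)
    (hc : ∀ x y z, μ x (φ y z) + φ x (μ y z) + (μ y (φ z x) + φ y (μ z x)) +
      (μ z (φ x y) + φ z (μ x y)) = 0) (s t : ℂ) :
    IsLieBracket (s • μ + t • φ) where
  alternating x := by simp [hμ.alternating, hφ.alternating]
  jacobi x y z := by
    have h₁ := hμ.jacobi x y z
    have h₂ := hφ.jacobi x y z
    have h₃ := hc x y z
    simp only [LinearMap.add_apply, LinearMap.smul_apply, map_add, map_smul]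
    linear_combination (norm := module) (s * s) • h₁ + (t * t) • h₂ + (s * t) • h₃

theorem isLinearDeformation_of_compatible {μ φ : Bil n} (hμ : IsLieBracket μ)
    (hφ : IsLieBracket φ)
    (hc : ∀ x y z, μ x (φ y z) + φ x (μ y z) + (μ y (φ z x) + φ y (μ z x)) +
      (μ z (φ x y) + φ z (μ x y)) = 0) :
    IsLinearDeformation μ φ where
  base := hμ
  direction := hφ
  family t _ := by
    have := hμ.smul_add_smul hφ hc 1 t
    rwa [one_smul] at this

theorem act_apply (g : (Fin n → ℂ) ≃ₗ[ℂ] (Fin n → ℂ)) (μ : Bil n) (x y : Fin n → ℂ) :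
    act g μ x y = g (μ (g.symm x) (g.symm y)) := rfl

theorem act_apply_map (g : (Fin n → ℂ) ≃ₗ[ℂ] (Fin n → ℂ)) (μ : Bil n) (x y : Fin n → ℂ) :
    act g μ (g x) (g y) = g (μ x y) := by
  simp [act_apply]

/-! ### Nilpotent brackets -/

/-- The derived algebra of `(ℂⁿ, μ)`. -/
abbrev derived (μ : Bil n) : Submodule ℂ (Fin n → ℂ) := Submodule.map₂ μ ⊤ ⊤

theorem mem_derived (μ : Bil n) (x y : Fin n → ℂ) : μ x y ∈ derived μ :=
  Submodule.apply_mem_map₂ _ trivial trivial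

/-- The identity, seen as a linear map from `ℂⁿ` to the Lie algebra `(ℂⁿ, μ)`. -/
def LieAlg.ofFun (μ : lieVariety n) : (Fin n → ℂ) →ₗ[ℂ] LieAlg μ where
  toFun x := x
  map_add' _ _ := rfl
  map_smul' _ _ := rfl

/-- The iterated brackets of the whole algebra with a subspace. -/
def iteratedBracket (μ : Bil n) (U : Submodule ℂ (Fin n → ℂ)) (k : ℕ) :
    Submodule ℂ (Fin n → ℂ) :=
  (Submodule.map₂ μ ⊤)^[k] U

theorem iteratedBracket_succ (μ : Bil n) (U : Submodule ℂ (Fin n → ℂ)) (k : ℕ) :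
    iteratedBracket μ U (k + 1) = Submodule.map₂ μ ⊤ (iteratedBracket μ U k) :=
  Function.iterate_succ_apply' _ _ _

theorem exists_iteratedBracket_eq_bot {μ : lieVariety n}
    (hnil : LieRing.IsNilpotent (LieAlg μ)) (U : Submodule ℂ (Fin n → ℂ)) :
    ∃ k, iteratedBracket (μ : Bil n) U k = ⊥ := by
  obtain ⟨k, hk⟩ := (LieModule.isNilpotent_iff ℂ (LieAlg μ) (LieAlg μ)).1 hnil
  have key : ∀ j, iteratedBracket (μ : Bil n) U j ≤
      (LieModule.lowerCentralSeries ℂ (LieAlg μ) (LieAlg μ) j).toSubmodule.comap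
        (LieAlg.ofFun μ) := by
    intro j
    induction j with
    | zero => exact fun x _ => trivial
    | succ j ih =>
      rw [iteratedBracket_succ, Submodule.map₂_le]
      intro x _ u hu
      rw [Submodule.mem_comap, LieModule.lowerCentralSeries_succ]
      exact LieSubmodule.lie_mem_lie (I := (⊤ : LieIdeal ℂ (LieAlg μ))) (x := x)
        (LieSubmodule.mem_top _) (ih hu)
  refine ⟨k, ?_⟩
  rw [eq_bot_iff]
  intro x hx
  have := key k hx
  rw [hk] at this
  exact this

/-- Nakayama's lemma for nilpotent Lie algebras: such a `U` lies in all its iterated brackets, and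
these eventually vanish. Most uses of nilpotency below go through this. -/
theorem eq_bot_of_le_bracket {μ : lieVariety n} (hnil : LieRing.IsNilpotent (LieAlg μ))
    {U : Submodule ℂ (Fin n → ℂ)} (hU : U ≤ Submodule.map₂ (μ : Bil n) ⊤ U) : U = ⊥ := by
  obtain ⟨k, hk⟩ := exists_iteratedBracket_eq_bot hnil U
  have : ∀ j, U ≤ iteratedBracket (μ : Bil n) U j := by
    intro j
    induction j with
    | zero => exact le_rfl
    | succ j ih =>
      rw [iteratedBracket_succ]
      exact hU.trans (Submodule.map₂_le_map₂ le_rfl ih)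
  exact eq_bot_iff.2 (hk ▸ this k)

/-- The last nonzero iterated bracket of the ideal `U` is central. -/
theorem exists_central_mem {μ : lieVariety n} (hnil : LieRing.IsNilpotent (LieAlg μ))
    {U : Submodule ℂ (Fin n → ℂ)} (hU : ∀ x, ∀ u ∈ U, (μ : Bil n) x u ∈ U) (hne : U ≠ ⊥) :
    ∃ z ∈ U, z ≠ 0 ∧ ∀ x, (μ : Bil n) x z = 0 := by
  classical
  have hex := exists_iteratedBracket_eq_bot hnil U
  have hle : ∀ j, iteratedBracket (μ : Bil n) U j ≤ U := by
    intro j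
    induction j with
    | zero => exact le_rfl
    | succ j ih =>
      rw [iteratedBracket_succ, Submodule.map₂_le]
      exact fun x _ u hu => hU x u (ih hu)
  obtain ⟨k, hk⟩ : ∃ k, Nat.find hex = k + 1 :=
    Nat.exists_eq_succ_of_ne_zero fun h0 => hne (by
      have := Nat.find_spec hex
      rwa [h0] at this)
  have h1 : iteratedBracket (μ : Bil n) U k ≠ ⊥ := Nat.find_min hex (by omega)
  have h2 : iteratedBracket (μ : Bil n) U (k + 1) = ⊥ := hk ▸ Nat.find_spec hex
  obtain ⟨z, hz, hz0⟩ := Submodule.exists_mem_ne_zero_of_ne_bot h1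
  refine ⟨z, hle k hz, hz0, fun x => ?_⟩
  have : (μ : Bil n) x z ∈ iteratedBracket (μ : Bil n) U (k + 1) := by
    rw [iteratedBracket_succ]
    exact Submodule.apply_mem_map₂ _ trivial hz
  rw [h2] at this
  exact this

/-- If one element `a` generated the algebra modulo its derived algebra, then `[a, a] = 0` would put
every bracket in the bracket of the algebra with its derived algebra. The latter would then be zero,
leaving dimension at most one. -/
theorem derived_sup_span_ne_top {μ : lieVariety n} (hnil : LieRing.IsNilpotent (LieAlg μ))
    (hn : 2 ≤ n) (a : Fin n → ℂ) :
    derived (μ : Bil n) ⊔ Submodule.span ℂ {a} ≠ ⊤ := by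
  intro htop
  have hle : derived (μ : Bil n) ≤ Submodule.map₂ (μ : Bil n) ⊤ (derived (μ : Bil n)) := by
    rw [derived, Submodule.map₂_le]
    intro x _ y _
    obtain ⟨u, hu, u', hu', rfl⟩ := Submodule.mem_sup.1 (htop ▸ Submodule.mem_top (x := x))
    obtain ⟨v, hv, v', hv', rfl⟩ := Submodule.mem_sup.1 (htop ▸ Submodule.mem_top (x := y))
    obtain ⟨α, rfl⟩ := Submodule.mem_span_singleton.1 hu'
    obtain ⟨β, rfl⟩ := Submodule.mem_span_singleton.1 hv'
    have : (μ : Bil n) (u + α • a) (v + β • a) =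
        (μ : Bil n) (u + α • a) v + (-β) • (μ : Bil n) a u := by
      rw [map_add, map_smul, μ.2.skew (u + α • a) a]
      simp [μ.2.alternating]
    rw [this]
    exact add_mem (Submodule.apply_mem_map₂ _ trivial hv)
      (Submodule.smul_mem _ _ (Submodule.apply_mem_map₂ _ trivial hu))
  have h0 := eq_bot_of_le_bracket hnil hle
  rw [h0, bot_sup_eq] at htop
  have h1 : Module.finrank ℂ (Submodule.span ℂ {a}) ≤ 1 :=
    (finrank_span_le_card _).trans (by simp)
  rw [htop, finrank_top, Module.finrank_fin_fun] at h1
  omega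

/-- Completes `f`, `a` to a biorthogonal system of two functionals and two vectors, the new
functional again vanishing on brackets. -/
theorem exists_dual_pair {μ : lieVariety n} (hnil : LieRing.IsNilpotent (LieAlg μ))
    (hn : 2 ≤ n) {f : (Fin n → ℂ) →ₗ[ℂ] ℂ} {a : Fin n → ℂ} (hfa : f a = 1) :
    ∃ (g : (Fin n → ℂ) →ₗ[ℂ] ℂ) (b : Fin n → ℂ),
      (∀ x y, g ((μ : Bil n) x y) = 0) ∧ g a = 0 ∧ g b = 1 ∧ f b = 0 := by
  obtain ⟨c, -, hc⟩ := SetLike.exists_of_lt (lt_top_iff_ne_top.2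
    (derived_sup_span_ne_top hnil hn a))
  obtain ⟨g, hg, hg'⟩ := Submodule.exists_dual_map_eq_bot_of_notMem hc inferInstance
  have hker : ∀ x ∈ derived (μ : Bil n) ⊔ Submodule.span ℂ {a}, g x = 0 := fun x hx => by
    have := Submodule.mem_map_of_mem (f := g) hx
    rwa [hg', Submodule.mem_bot] at this
  have hga : g a = 0 :=
    hker a (Submodule.mem_sup_right (Submodule.mem_span_singleton_self a))
  refine ⟨(g c)⁻¹ • g, c - f c • a, fun x y => ?_, ?_, ?_, ?_⟩
  · simp [hker _ (Submodule.mem_sup_left (mem_derived (μ : Bil n) x y))]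
  · simp [hga]
  · simp [hga, hg]
  · simp [hfa]

theorem exists_dual_derived {μ : lieVariety n} (hnil : LieRing.IsNilpotent (LieAlg μ))
    (hn : 2 ≤ n) : ∃ (f : (Fin n → ℂ) →ₗ[ℂ] ℂ) (a : Fin n → ℂ),
      (∀ x y, f ((μ : Bil n) x y) = 0) ∧ f a = 1 := by
  have : derived (μ : Bil n) ≠ ⊤ := by simpa using derived_sup_span_ne_top hnil hn 0
  obtain ⟨c, -, hc⟩ := SetLike.exists_of_lt (lt_top_iff_ne_top.2 this)
  obtain ⟨f, hf, hf'⟩ := Submodule.exists_dual_map_eq_bot_of_notMem hc inferInstance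
  refine ⟨(f c)⁻¹ • f, c, fun x y => ?_, by simp [hf]⟩
  have := Submodule.mem_map_of_mem (f := f) (mem_derived (μ : Bil n) x y)
  rw [hf', Submodule.mem_bot] at this
  simp [this]

/-! ### Brackets with values in a line -/

/-- The bilinear map `(f ∧ g) ⊗ z`. -/
def wedge (f g : (Fin n → ℂ) →ₗ[ℂ] ℂ) (z : Fin n → ℂ) : Bil n :=
  LinearMap.mk₂ ℂ (fun x y => (f x * g y - f y * g x) • z)
    (fun x x' y => by simp only [map_add]; module)
    (fun c x y => by simp only [map_smul, smul_eq_mul]; module)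
    (fun x y y' => by simp only [map_add]; module)
    (fun c x y => by simp only [map_smul, smul_eq_mul]; module)

theorem wedge_apply (f g : (Fin n → ℂ) →ₗ[ℂ] ℂ) (z x y : Fin n → ℂ) :
    wedge f g z x y = (f x * g y - f y * g x) • z := rfl

theorem isLieBracket_sum_wedge {ι : Type*} [Fintype ι] {f g : ι → (Fin n → ℂ) →ₗ[ℂ] ℂ}
    {z : Fin n → ℂ} (hf : ∀ i, f i z = 0) (hg : ∀ i, g i z = 0) :
    IsLieBracket (∑ i, wedge (f i) (g i) z) where
  alternating x := by simp [LinearMap.sum_apply, wedge_apply]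
  jacobi x y w := by simp [LinearMap.sum_apply, wedge_apply, hf, hg]

/-! ### Degenerations along a line -/

/-- If automorphisms of `μ` rescale `ψ` arbitrarily, then `μ` lies in the orbit closure of every
`μ + t ψ`. -/
theorem mem_zariskiClosure_orbit_of_rescaling {μ ψ : Bil n}
    (h : ∀ s : ℂ, s ≠ 0 → ∃ g, act g μ = μ ∧ act g ψ = s • ψ) {t : ℂ} (ht : t ≠ 0) :
    μ ∈ zariskiClosure (orbit (μ + t • ψ)) := by
  intro p hp
  let c : Fin n × Fin n × Fin n → Polynomial ℂ := fun i =>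
    Polynomial.C (structureConstants μ i) + Polynomial.C (structureConstants ψ i) * Polynomial.X
  let q : Polynomial ℂ := MvPolynomial.aeval c p
  have hq : ∀ s : ℂ, q.eval s = MvPolynomial.eval (structureConstants (μ + s • ψ)) p := by
    intro s
    have : (Polynomial.evalRingHom s).comp (MvPolynomial.aeval c).toRingHom =
        MvPolynomial.eval (structureConstants (μ + s • ψ)) := by
      refine MvPolynomial.ringHom_ext (fun a => by simp) fun i => ?_
      simp [c, structureConstants, mul_comm s]
    exact congrArg (fun F => F p) this
  have hroot : ∀ s : ℂ, s ≠ 0 → q.eval s = 0 := by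
    intro s hs
    rw [hq]
    refine hp _ ?_
    -- The factor `t⁻¹ * s` makes `g` carry `μ + tψ` to `μ + sψ`.
    obtain ⟨g, hgμ, hgψ⟩ := h (t⁻¹ * s) (mul_ne_zero (inv_ne_zero ht) hs)
    refine ⟨g, ?_⟩
    refine LinearMap.ext₂ fun x y => ?_
    have h₁ := congrArg (fun F : Bil n => F x y) hgμ
    have h₂ := congrArg (fun F : Bil n => F x y) hgψ
    simp only [act_apply, LinearMap.smul_apply] at h₁ h₂
    simp only [act_apply, LinearMap.add_apply, LinearMap.smul_apply, map_add, map_smul, h₁, h₂,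
      smul_smul]
    rw [mul_inv_cancel_left₀ ht]
  have hq0 : q = 0 := by
    refine Polynomial.eq_zero_of_infinite_isRoot q (Set.Infinite.mono (s := {0}ᶜ) ?_ ?_)
    · exact fun s hs => hroot s hs
    · exact (Set.finite_singleton 0).infinite_compl
  have := hq 0
  rw [hq0, zero_smul, add_zero, Polynomial.eval_zero] at this
  exact this.symm

/-! ### Deforming by a derivation of an ideal of codimension one -/

/-- The bilinear map `f ∧ D`. -/
def wedgeEnd (f : (Fin n → ℂ) →ₗ[ℂ] ℂ) (D : Module.End ℂ (Fin n → ℂ)) : Bil n :=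
  LinearMap.mk₂ ℂ (fun x y => f x • D y - f y • D x)
    (fun x x' y => by simp only [map_add]; module)
    (fun c x y => by simp only [map_smul, smul_eq_mul]; module)
    (fun x y y' => by simp only [map_add]; module)
    (fun c x y => by simp only [map_smul, smul_eq_mul]; module)

theorem wedgeEnd_apply (f : (Fin n → ℂ) →ₗ[ℂ] ℂ) (D : Module.End ℂ (Fin n → ℂ))
    (x y : Fin n → ℂ) : wedgeEnd f D x y = f x • D y - f y • D x := rfl

theorem isLieBracket_wedgeEnd {f : (Fin n → ℂ) →ₗ[ℂ] ℂ} {D : Module.End ℂ (Fin n → ℂ)} {l : ℂ}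
    (hfD : ∀ x, f (D x) = l * f x) : IsLieBracket (wedgeEnd f D) where
  alternating x := by simp [wedgeEnd_apply]
  jacobi x y z := by
    simp only [wedgeEnd_apply, map_sub, map_smul, hfD]
    module

theorem isLinearDeformation_wedgeEnd {μ : Bil n} (hμ : IsLieBracket μ)
    {f : (Fin n → ℂ) →ₗ[ℂ] ℂ} {D : Module.End ℂ (Fin n → ℂ)} {l : ℂ}
    (hD : ∀ x y, D (μ x y) = μ (D x) y + μ x (D y))
    (hfD : ∀ x, f (D x) = l * f x) (hf : ∀ x y, f (μ x y) = 0) :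
    IsLinearDeformation μ (wedgeEnd f D) := by
  refine isLinearDeformation_of_compatible hμ (isLieBracket_wedgeEnd hfD) fun x y z => ?_
  simp only [wedgeEnd_apply, map_sub, map_smul, hf, hD, zero_smul, sub_zero]
  rw [hμ.skew (D y) z, hμ.skew (D z) x, hμ.skew (D x) y]
  module

/-- Otherwise the image of `D`, spanned by the eigenvectors with nonzero eigenvalue, would be
contained in `D [𝔤, 𝔤]`. By the Leibniz rule this is contained in `[𝔤, D 𝔤]`, so the image would be
zero by Nakayama. -/
theorem exists_eigenvector_notMem_derived {μ : lieVariety n}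
    (hnil : LieRing.IsNilpotent (LieAlg μ)) {D : Module.End ℂ (Fin n → ℂ)}
    (hD : ∀ x y, D ((μ : Bil n) x y) = (μ : Bil n) (D x) y + (μ : Bil n) x (D y))
    (hss : D.IsSemisimple) (hD0 : D ≠ 0) :
    ∃ (X : Fin n → ℂ) (l : ℂ), l ≠ 0 ∧ D X = l • X ∧ X ∉ derived (μ : Bil n) := by
  by_contra! hcon
  have h₁ : LinearMap.range D ≤ (derived (μ : Bil n)).map D := by
    rw [LinearMap.range_eq_map,
      ← hss.iSup_eigenspace_eq_top,
      Submodule.map_iSup, iSup_le_iff]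
    rintro l _ ⟨x, hx, rfl⟩
    have hx : D x = l • x := Module.End.mem_eigenspace_iff.1 hx
    by_cases hl : l = 0
    · simp [hx, hl]
    · exact Submodule.mem_map_of_mem (hcon x l hl hx)
  have h₂ : (derived (μ : Bil n)).map D ≤
      Submodule.map₂ (μ : Bil n) ⊤ (LinearMap.range D) := by
    rw [Submodule.map_le_iff_le_comap, derived, Submodule.map₂_le]
    intro x _ y _
    rw [Submodule.mem_comap, hD, μ.2.skew (D x)]
    exact add_mem (neg_mem (Submodule.apply_mem_map₂ _ trivial ⟨x, rfl⟩))
      (Submodule.apply_mem_map₂ _ trivial ⟨y, rfl⟩)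
  exact hD0 (LinearMap.range_eq_bot.1 (eq_bot_of_le_bracket hnil (h₁.trans h₂)))

theorem exists_eigenfunctional {μ : lieVariety n}
    (hnil : LieRing.IsNilpotent (LieAlg μ)) {D : Module.End ℂ (Fin n → ℂ)}
    (hD : ∀ x y, D ((μ : Bil n) x y) = (μ : Bil n) (D x) y + (μ : Bil n) x (D y))
    (hss : D.IsSemisimple) (hD0 : D ≠ 0) :
    ∃ (X : Fin n → ℂ) (l : ℂ) (f : (Fin n → ℂ) →ₗ[ℂ] ℂ), l ≠ 0 ∧ D X = l • X ∧ f X = 1 ∧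
      (∀ x, f (D x) = l * f x) ∧ ∀ x y, f ((μ : Bil n) x y) = 0 := by
  obtain ⟨X, l, hl, hX, hXd⟩ := exists_eigenvector_notMem_derived hnil hD hss hD0
  have hder : derived (μ : Bil n) ≤ (derived (μ : Bil n)).comap D := by
    rw [Submodule.map₂_le]
    intro x _ y _
    rw [Submodule.mem_comap, hD]
    exact add_mem (mem_derived _ _ _) (mem_derived _ _ _)
  have hspan : Submodule.span ℂ {X} ≤ (Submodule.span ℂ {X}).comap D := by
    rw [Submodule.span_singleton_le_iff_mem, Submodule.mem_comap, hX]
    exact Submodule.smul_mem _ _ (Submodule.mem_span_singleton_self X)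
  -- A `D`-stable complement `W`: the functional that kills `W` and the derived algebra is an
  -- eigenvector of the transpose of `D`.
  obtain ⟨W, hW, hc⟩ := Module.End.isSemisimple_iff.1 hss
    (derived (μ : Bil n) ⊔ Submodule.span ℂ {X})
    (sup_le (hder.trans (Submodule.comap_mono le_sup_left))
      (hspan.trans (Submodule.comap_mono le_sup_right)))
  have hXW : X ∉ derived (μ : Bil n) ⊔ W := by
    intro hmem
    obtain ⟨u, hu, w, hw, huw⟩ := Submodule.mem_sup.1 hmem
    have hw' : w ∈ derived (μ : Bil n) ⊔ Submodule.span ℂ {X} := by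
      rw [← eq_sub_iff_add_eq'] at huw
      rw [huw]
      exact sub_mem (Submodule.mem_sup_right (Submodule.mem_span_singleton_self X))
        (Submodule.mem_sup_left hu)
    have hw0 : w = 0 := (Submodule.disjoint_def.1 hc.disjoint) w hw' hw
    rw [hw0, add_zero] at huw
    exact hXd (huw ▸ hu)
  obtain ⟨f, hf, hf'⟩ := Submodule.exists_dual_map_eq_bot_of_notMem hXW inferInstance
  have hker : ∀ x ∈ derived (μ : Bil n) ⊔ W, f x = 0 := fun x hx => by
    have := Submodule.mem_map_of_mem (f := f) hx
    rwa [hf', Submodule.mem_bot] at this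
  have hfD : ∀ x, f (D x) = l * f x := by
    intro x
    have hx : x ∈ derived (μ : Bil n) ⊔ Submodule.span ℂ {X} ⊔ W :=
      hc.sup_eq_top ▸ Submodule.mem_top
    obtain ⟨y, hy, w, hw, rfl⟩ := Submodule.mem_sup.1 hx
    obtain ⟨u, hu, v, hv, rfl⟩ := Submodule.mem_sup.1 hy
    obtain ⟨a, rfl⟩ := Submodule.mem_span_singleton.1 hv
    simp only [map_add, map_smul, hX, hker u (Submodule.mem_sup_left hu),
      hker w (Submodule.mem_sup_right hw), hker _ (Submodule.mem_sup_left (hder hu)),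
      hker _ (Submodule.mem_sup_right (hW hw)), smul_eq_mul]
    ring
  refine ⟨X, l, (f X)⁻¹ • f, hl, hX, by simp [hf], fun x => ?_, fun x y => ?_⟩
  · simp only [LinearMap.smul_apply, hfD, smul_eq_mul]
    ring
  · simp [hker _ (Submodule.mem_sup_left (mem_derived (μ : Bil n) x y))]

/-- Some polynomial in `D` acts on the eigenvectors of `D` by prescribed functions of the
eigenvalues. -/
theorem exists_commute_smul_eigenvector (D : Module.End ℂ (Fin n → ℂ)) (e : ℂ → ℂ) :
    ∃ G : Module.End ℂ (Fin n → ℂ), Commute G D ∧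
      ∀ (a : ℂ) (v : Fin n → ℂ), D v = a • v → G v = e a • v := by
  classical
  have hfin : (Set.Finite {a | D.HasEigenvalue a}) := D.finite_hasEigenvalue
  let S := hfin.toFinset
  refine ⟨Polynomial.aeval D (Lagrange.interpolate S id e),
    by simpa using (Commute.all (Lagrange.interpolate S id e) Polynomial.X).map (Polynomial.aeval D),
    fun a v hv => ?_⟩
  by_cases hv0 : v = 0
  · simp [hv0]
  have hvec : D.HasEigenvector a v := ⟨Module.End.mem_eigenspace_iff.2 hv, hv0⟩
  have ha : a ∈ S := hfin.mem_toFinset.2 (Module.End.hasEigenvalue_of_hasEigenvector hvec)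
  rw [Module.End.aeval_apply_of_hasEigenvector hvec]
  have := Lagrange.eval_interpolate_at_node e (s := S) (v := id) Function.injective_id.injOn ha
  rw [id] at this
  rw [this]

theorem induction_eigenvector {D : Module.End ℂ (Fin n → ℂ)} (hss : D.IsSemisimple)
    {p : (Fin n → ℂ) → Prop} (x : Fin n → ℂ) (h : ∀ (a : ℂ) (v), D v = a • v → p v)
    (hadd : ∀ v w, p v → p w → p (v + w)) : p x := by
  have hx : x ∈ ⨆ a, D.eigenspace a :=
    hss.iSup_eigenspace_eq_top ▸
      Submodule.mem_top
  refine Submodule.iSup_induction _ (motive := p) hx (fun a v hv => ?_) (h 0 0 (by simp)) hadd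
  exact h a v (Module.End.mem_eigenspace_iff.1 hv)

theorem exists_automorphism_rescaling_wedgeEnd {μ : Bil n} {D : Module.End ℂ (Fin n → ℂ)}
    (hD : ∀ x y, D (μ x y) = μ (D x) y + μ x (D y)) (hss : D.IsSemisimple)
    {f : (Fin n → ℂ) →ₗ[ℂ] ℂ} {l : ℂ} (hl : l ≠ 0) (hfD : ∀ x, f (D x) = l * f x)
    {s : ℂ} (hs : s ≠ 0) :
    ∃ g, act g μ = μ ∧ act g (wedgeEnd f D) = s • wedgeEnd f D := by
  obtain ⟨c, hc⟩ : ∃ c : ℂ, Complex.exp (-(c * l)) = s :=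
    ⟨-Complex.log s / l, by rw [div_mul_cancel₀ _ hl, neg_neg, Complex.exp_log hs]⟩
  -- `G` is `exp (cD)` and `G'` its inverse, both obtained as polynomials in `D`.
  obtain ⟨G, hGD, hG⟩ := exists_commute_smul_eigenvector D fun a => Complex.exp (c * a)
  obtain ⟨G', -, hG'⟩ := exists_commute_smul_eigenvector D fun a => Complex.exp (-(c * a))
  have hGG' : G ∘ₗ G' = LinearMap.id := by
    refine LinearMap.ext fun x => ?_
    refine induction_eigenvector hss (p := fun x => (G ∘ₗ G') x = LinearMap.id x) x
      (fun a v hv => ?_) fun v w hv hw => ?_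
    · simp [hG' a v hv, hG a v hv, smul_smul, ← Complex.exp_add]
    · rw [map_add, hv, hw, map_add]
  have hG'G : G' ∘ₗ G = LinearMap.id := by
    refine LinearMap.ext fun x => ?_
    refine induction_eigenvector hss (p := fun x => (G' ∘ₗ G) x = LinearMap.id x) x
      (fun a v hv => ?_) fun v w hv hw => ?_
    · simp [hG' a v hv, hG a v hv, smul_smul, ← Complex.exp_add]
    · rw [map_add, hv, hw, map_add]
  let g : (Fin n → ℂ) ≃ₗ[ℂ] (Fin n → ℂ) := LinearEquiv.ofLinearMap G G' hGG' hG'G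
  have hgs : ∀ x, g.symm x = G' x := fun x => rfl
  have hg : ∀ x, g x = G x := fun x => rfl
  have hGG'x : ∀ x, G (G' x) = x := fun x => congrArg (fun F => F x) hGG'
  have hmul : ∀ x y, G (μ x y) = μ (G x) (G y) := by
    intro x y
    refine induction_eigenvector hss (p := fun x => G (μ x y) = μ (G x) (G y)) x
      (fun a v hv => ?_) fun v w hv hw => ?_
    · refine induction_eigenvector hss (p := fun y => G (μ v y) = μ (G v) (G y)) y (fun b w hw => ?_) fun w w' hw hw' => ?_
      · have : D (μ v w) = (a + b) • μ v w := by
          rw [hD, hv, hw]; simp [add_smul]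
        rw [hG _ _ this, hG a v hv, hG b w hw]
        simp [smul_smul, mul_add, Complex.exp_add, mul_comm]
      · simp [hw, hw']
    · simp [hv, hw]
  have hf : ∀ x, f (G' x) = s * f x := by
    intro x
    refine induction_eigenvector hss (p := fun x => f (G' x) = s * f x) x
      (fun a v hv => ?_) fun v w hv hw => ?_
    · rw [hG' a v hv, map_smul, smul_eq_mul]
      by_cases hfv : f v = 0
      · simp [hfv]
      · have := hfD v
        rw [hv, map_smul, smul_eq_mul] at this
        rw [mul_right_cancel₀ hfv this, hc]
    · simp [hv, hw, mul_add]
  have hcomm : ∀ x, G (D (G' x)) = D x := fun x => by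
    have : G (D (G' x)) = D (G (G' x)) := congrArg (fun F => F (G' x)) hGD.eq
    rw [this, hGG'x]
  refine ⟨g, ?_, ?_⟩
  · refine LinearMap.ext₂ fun x y => ?_
    rw [act_apply, hg, hgs, hgs, hmul, hGG'x, hGG'x]
  · refine LinearMap.ext₂ fun x y => ?_
    rw [act_apply, hg, hgs, hgs, wedgeEnd_apply, map_sub, map_smul, map_smul, hcomm, hcomm, hf, hf,
      LinearMap.smul_apply, LinearMap.smul_apply, wedgeEnd_apply]
    module

/-- In a nilpotent Lie algebra, the adjoint maps have no nonzero eigenvalue. -/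
theorem eq_zero_of_bracket_eq_smul {μ : lieVariety n} (hnil : LieRing.IsNilpotent (LieAlg μ))
    {x v : Fin n → ℂ} {c : ℂ} (hc : c ≠ 0) (h : (μ : Bil n) x v = c • v) : v = 0 := by
  have : Submodule.span ℂ {v} = ⊥ := by
    refine eq_bot_of_le_bracket hnil ?_
    rw [Submodule.span_singleton_le_iff_mem]
    have : v = (μ : Bil n) x (c⁻¹ • v) := by rw [map_smul, h, smul_smul, inv_mul_cancel₀ hc, one_smul]
    rw [this]
    exact Submodule.apply_mem_map₂ _ trivial
      (Submodule.smul_mem _ _ (by rw [← this]; exact Submodule.mem_span_singleton_self v))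
  exact Submodule.span_singleton_eq_bot.1 this

theorem isNilpotent_bracket {μ : lieVariety n} (hnil : LieRing.IsNilpotent (LieAlg μ))
    (x : Fin n → ℂ) : ∃ k, ∀ v, (((μ : Bil n) x) ^ k) v = 0 := by
  obtain ⟨k, hk⟩ := exists_iteratedBracket_eq_bot hnil ⊤
  have : ∀ j v, (((μ : Bil n) x) ^ j) v ∈ iteratedBracket (μ : Bil n) ⊤ j := by
    intro j
    induction j with
    | zero => exact fun v => trivial
    | succ j ih =>
      intro v
      rw [iteratedBracket_succ, pow_succ', Module.End.mul_apply]
      exact Submodule.apply_mem_map₂ _ trivial (ih v)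
  exact ⟨k, fun v => by simpa [hk] using this k v⟩

/-- Let `D` be a derivation with `[D, N] = l N`, `l ≠ 0`. If `N + tD` has no nonzero eigenvalue on
`ker f` and `N` is nilpotent, then `D` has no nonzero eigenvalue on `ker f`. -/
theorem eigenvector_eq_zero_of_perturbation {N D : Module.End ℂ (Fin n → ℂ)}
    {f : (Fin n → ℂ) →ₗ[ℂ] ℂ} {l t : ℂ} (hl : l ≠ 0) (ht : t ≠ 0)
    (hDN : ∀ x, D (N x) = l • N x + N (D x)) (hfN : ∀ x, f (N x) = 0)
    (hT : ∀ (c : ℂ) (v), c ≠ 0 → f v = 0 → N v + t • D v = c • v → v = 0) (k : ℕ) :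
    ∀ (a : ℂ) (v), a ≠ 0 → f v = 0 → D v = a • v → (N ^ k) v = 0 → v = 0 := by
  induction k with
  | zero => exact fun a v _ _ _ h => by simpa using h
  | succ k ih =>
    intro a v ha hfv hv hk
    rw [pow_succ, Module.End.mul_apply] at hk
    have hDw : D (N v) = (l + a) • N v := by rw [hDN, hv, map_smul, add_smul]
    -- `N` shifts `D`-eigenvalues by `l`. If `l + a ≠ 0`, induction gives `N v = 0`, and `v` is an
    -- eigenvector of `N + tD` with eigenvalue `t a`. If `l + a = 0`, then `D (N v) = 0` and
    -- induction only gives `N (N v) = 0`; the eigenvector for `t a` is then `t a v + N v`.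
    by_cases hla : l + a = 0
    · rw [hla, zero_smul] at hDw
      have hNw : N (N v) = 0 := by
        refine ih l _ hl (hfN _) (by rw [hDN, hDw, map_zero, add_zero]) ?_
        rw [← Module.End.mul_apply, ← pow_succ, pow_succ', Module.End.mul_apply, hk, map_zero]
      have h0 : (t * a) • v + N v = 0 := by
        refine hT (t * a) _ (mul_ne_zero ht ha) (by simp [hfv, hfN]) ?_
        simp only [map_add, map_smul, hNw, hDw, hv]
        module
      have h1 := congrArg D h0
      simp only [map_add, map_smul, hDw, hv, add_zero, map_zero, smul_smul] at h1
      exact (smul_eq_zero.1 h1).resolve_left (by simp [ht, ha])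
    · have hw := ih _ _ hla (hfN v) hDw hk
      refine hT (t * a) v (mul_ne_zero ht ha) hfv ?_
      rw [hw, hv, zero_add, smul_smul]

theorem notMem_orbit_add_wedgeEnd {μ : lieVariety n}
    (hnil : LieRing.IsNilpotent (LieAlg μ)) {D : Module.End ℂ (Fin n → ℂ)}
    (hD : ∀ x y, D ((μ : Bil n) x y) = (μ : Bil n) (D x) y + (μ : Bil n) x (D y))
    (hss : D.IsSemisimple) {X : Fin n → ℂ} {l : ℂ} {f : (Fin n → ℂ) →ₗ[ℂ] ℂ}
    (hl : l ≠ 0) (hX : D X = l • X) (hfX : f X = 1) (hfD : ∀ x, f (D x) = l * f x)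
    (hf : ∀ x y, f ((μ : Bil n) x y) = 0) (hne : ∃ x, f x = 0 ∧ D x ≠ 0) {t : ℂ} (ht : t ≠ 0) :
    (μ : Bil n) ∉ orbit ((μ : Bil n) + t • wedgeEnd f D) := by
  rintro ⟨g, hg⟩
  obtain ⟨k, hk⟩ := isNilpotent_bracket hnil X
  have hT : ∀ (c : ℂ) (v : Fin n → ℂ), c ≠ 0 → f v = 0 →
      (μ : Bil n) X v + t • D v = c • v → v = 0 := by
    intro c v hc hfv hv
    -- An isomorphism `g` would turn `ad X + tD` on `ker f` into an adjoint map of the nilpotent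
    -- bracket `μ`.
    have h : (μ : Bil n) (g X) (g v) = c • g v := by
      rw [hg, act_apply_map, ← map_smul, ← hv]
      simp [wedgeEnd_apply, hfX, hfv]
    exact g.map_eq_zero_iff.1 (eq_zero_of_bracket_eq_smul hnil hc h)
  have key : ∀ (a : ℂ) (v : Fin n → ℂ), a ≠ 0 → f v = 0 → D v = a • v → v = 0 :=
    fun a v ha hfv hv => eigenvector_eq_zero_of_perturbation (N := (μ : Bil n) X) hl ht
      (fun x => by rw [hD, hX]; simp) (hf X) hT k a v ha hfv hv (hk v)
  obtain ⟨x, hfx, hDx⟩ := hne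
  have hmul : D x = (f x * l) • X := by
    refine induction_eigenvector hss (p := fun x => D x = (f x * l) • X) x
      (fun a v hv => ?_) fun v w hv hw => ?_
    · have hfv := hfD v
      rw [hv, map_smul, smul_eq_mul] at hfv
      by_cases ha : a = 0
      · have : f v = 0 := by
          rw [ha, zero_mul, eq_comm, mul_eq_zero] at hfv
          exact hfv.resolve_left hl
        rw [hv, ha, this]; simp
      by_cases hfv0 : f v = 0
      · rw [key a v ha hfv0 hv]; simp
      · have hal : a = l := mul_right_cancel₀ hfv0 hfv
        subst hal
        -- An eigenvector outside `ker f` has eigenvalue `l`; subtracting its component along `X`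
        -- moves it into `ker f`.
        have := key a (v - f v • X) ha (by simp [hfX]) (by simp [hv, hX, smul_sub, smul_smul, mul_comm])
        rw [sub_eq_zero.1 this]
        simp [hX, hfX, smul_smul]
    · rw [map_add, hv, hw, map_add]; module
  rw [hfx, zero_mul, zero_smul] at hmul
  exact hDx hmul

/-! ### Deforming by an outer derivation of a direct factor -/

theorem isLieBracket_wedge {f g : (Fin n → ℂ) →ₗ[ℂ] ℂ} {z : Fin n → ℂ} (hf : f z = 0)
    (hg : g z = 0) : IsLieBracket (wedge f g z) where
  alternating x := by simp [wedge_apply]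
  jacobi x y w := by simp [wedge_apply, hf, hg]

theorem finrank_ker_act (g : (Fin n → ℂ) ≃ₗ[ℂ] (Fin n → ℂ)) (μ : Bil n) :
    Module.finrank ℂ (LinearMap.ker (act g μ)) = Module.finrank ℂ (LinearMap.ker μ) := by
  have : LinearMap.ker (act g μ) = (LinearMap.ker μ).map g.toLinearMap := by
    ext x
    rw [LinearMap.mem_ker, Submodule.mem_map]
    constructor
    · intro h
      refine ⟨g.symm x, ?_, g.apply_symm_apply x⟩
      rw [LinearMap.mem_ker]
      refine LinearMap.ext fun y => ?_
      have := congrArg (fun F => F (g y)) h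
      simpa [act_apply] using this
    · rintro ⟨y, hy, rfl⟩
      rw [LinearMap.mem_ker] at hy
      refine LinearMap.ext fun w => ?_
      simp [act_apply, hy]
  rw [this]
  exact LinearEquiv.finrank_map_eq g _

theorem ker_inf_ker_ne_bot (hn : 3 ≤ n) (f g : (Fin n → ℂ) →ₗ[ℂ] ℂ) :
    LinearMap.ker f ⊓ LinearMap.ker g ≠ ⊥ := by
  intro h
  have hinj : Function.Injective (f.prod g) := by
    rw [← LinearMap.ker_eq_bot, LinearMap.ker_prod, h]
  have := LinearMap.finrank_le_finrank_of_injective hinj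
  simp at this
  omega

/-- `X` spans a direct factor, so rescaling `X` alone is an automorphism of `μ` and rescales `ψ`.
The new bracket sends `(X, Y)` to `t z`: `X` leaves the centre. The choice of `z` outside `[Y, C]`
ensures that no combination of `X` with elements of the other factor becomes central instead. -/
theorem exists_degeneration_of_central {μ : lieVariety n}
    (hnil : LieRing.IsNilpotent (LieAlg μ)) (hn : 3 ≤ n) {X : Fin n → ℂ}
    {f : (Fin n → ℂ) →ₗ[ℂ] ℂ} (hfX : f X = 1) (hf : ∀ x y, f ((μ : Bil n) x y) = 0)
    (hX : ∀ y, (μ : Bil n) X y = 0) :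
    ∃ ψ : Bil n, IsLinearDeformation (μ : Bil n) ψ ∧
      ∀ t : ℂ, t ≠ 0 → DegeneratesTo ((μ : Bil n) + t • ψ) (μ : Bil n) := by
  obtain ⟨g, Y, hg, hgX, hgY, hfY⟩ := exists_dual_pair hnil (by omega) hfX
  -- The centre of the ideal `ker f ⊓ ker g`.
  let C : Submodule ℂ (Fin n → ℂ) :=
    { carrier := {u | f u = 0 ∧ g u = 0 ∧ ∀ y, f y = 0 → g y = 0 → (μ : Bil n) u y = 0}
      zero_mem' := by simp
      add_mem' := by
        rintro u v ⟨h₁, h₂, h₃⟩ ⟨h₁', h₂', h₃'⟩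
        exact ⟨by simp [h₁, h₁'], by simp [h₂, h₂'],
          fun y hy hy' => by simp [h₃ y hy hy', h₃' y hy hy']⟩
      smul_mem' := by
        rintro c u ⟨h₁, h₂, h₃⟩
        exact ⟨by simp [h₁], by simp [h₂], fun y hy hy' => by simp [h₃ y hy hy']⟩ }
  have hCne : C ≠ ⊥ := by
    obtain ⟨z, hz, hz0, hzc⟩ := exists_central_mem hnil
      (U := LinearMap.ker f ⊓ LinearMap.ker g) (fun x u _ => ⟨hf x u, hg x u⟩)
      (ker_inf_ker_ne_bot hn f g)
    refine (Submodule.ne_bot_iff _).2 ⟨z, ⟨hz.1, hz.2, fun y _ _ => ?_⟩, hz0⟩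
    rw [μ.2.skew, hzc, neg_zero]
  -- If `ad Y` mapped `C` onto a space containing `C`, Nakayama would give `C = 0`.
  obtain ⟨z, hzC, hzY⟩ : ∃ z ∈ C, z ∉ C.map ((μ : Bil n) Y) := by
    by_contra! hcon
    refine hCne (eq_bot_of_le_bracket hnil fun z hz => ?_)
    obtain ⟨u, hu, rfl⟩ := hcon z hz
    exact Submodule.apply_mem_map₂ _ trivial hu
  obtain ⟨hfz, hgz, hzk⟩ := hzC
  have hdecomp : ∀ u ∈ C, ∀ x, (μ : Bil n) x u = g x • (μ : Bil n) Y u := by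
    rintro u ⟨-, -, hu⟩ x
    have h := hu (x - f x • X - g x • Y) (by simp [hfX, hfY]) (by simp [hgX, hgY])
    rw [μ.2.skew, neg_eq_zero] at h
    simp only [map_sub, map_smul, LinearMap.sub_apply, LinearMap.smul_apply, hX, smul_zero,
      sub_zero, sub_eq_zero] at h
    exact h
  have hμz := hdecomp z ⟨hfz, hgz, hzk⟩
  refine ⟨wedge f g z, ?_, fun t ht => ⟨?_, ?_⟩⟩
  · refine isLinearDeformation_of_compatible μ.2 (isLieBracket_wedge hfz hgz) fun x y w => ?_
    simp only [wedge_apply, map_smul, hf, hg, hμz x, hμz y, hμz w]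
    module
  · refine mem_zariskiClosure_orbit_of_rescaling (fun s hs => ?_) ht
    have hinv : ∀ a b : ℂ, a * b = 1 →
        (LinearMap.id + (a - 1) • f.smulRight X) ∘ₗ (LinearMap.id + (b - 1) • f.smulRight X) =
          LinearMap.id := by
      intro a b hab
      refine LinearMap.ext fun x => ?_
      simp only [LinearMap.comp_apply, LinearMap.add_apply, LinearMap.id_apply,
        LinearMap.smul_apply, LinearMap.smulRight_apply, map_add, map_smul, hfX]
      linear_combination (norm := module) (f x * hab) • X
    refine ⟨LinearEquiv.ofLinearMap _ _ (hinv s⁻¹ s (inv_mul_cancel₀ hs))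
      (hinv s s⁻¹ (mul_inv_cancel₀ hs)), ?_, ?_⟩
    · refine LinearMap.ext₂ fun x y => ?_
      have hX' : ∀ y, (μ : Bil n) y X = 0 := fun y => by rw [μ.2.skew, hX, neg_zero]
      simp [act_apply, hX, hX', hf]
    · refine LinearMap.ext₂ fun x y => ?_
      simp [act_apply, wedge_apply, hfX, hgX, hfz]
      module
  · rintro ⟨h, hh⟩
    -- The kernel of a bracket, as a map into endomorphisms, is its centre, and its dimension is an
    -- isomorphism invariant.
    have hlt : LinearMap.ker ((μ : Bil n) + t • wedge f g z) < LinearMap.ker (μ : Bil n) := by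
      refine lt_of_le_of_ne (fun x hx => ?_) fun heq => ?_
      · have hx' : ∀ y, (μ : Bil n) x y + (t * (f x * g y - f y * g x)) • z = 0 := fun y => by
          have := congrArg (fun F => F y) (LinearMap.mem_ker.1 hx)
          simpa [wedge_apply, smul_smul] using this
        have hz0 : z ≠ 0 := fun h0 => hzY (h0 ▸ zero_mem _)
        have hgx : g x = 0 := by
          have := hx' X
          rw [μ.2.skew, hX, hfX, hgX] at this
          simpa [ht, hz0] using this
        have hu : x - f x • X ∈ C := by
          refine ⟨by simp [hfX], by simp [hgx, hgX], fun y hfy hgy => ?_⟩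
          have := hx' y
          rw [hfy, hgy] at this
          simpa [hX] using this
        -- A central `x` of the deformed bracket with `f x ≠ 0` would exhibit `z` as an element of
        -- `[Y, C]`.
        have hxY : (μ : Bil n) Y (x - f x • X) = (t * f x) • z := by
          have := hx' Y
          rw [hgY, hfY, μ.2.skew] at this
          rw [map_sub, map_smul, μ.2.skew Y X, hX]
          simp only [mul_one, zero_mul, sub_zero, neg_add_eq_zero] at this
          simpa using this
        have hfx : f x = 0 := by
          by_contra hfx
          refine hzY ⟨(t * f x)⁻¹ • (x - f x • X), Submodule.smul_mem _ _ hu, ?_⟩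
          rw [map_smul, hxY, smul_smul, inv_mul_cancel₀ (mul_ne_zero ht hfx), one_smul]
        rw [LinearMap.mem_ker]
        refine LinearMap.ext fun y => ?_
        simpa [hfx, hgx] using hx' y
      · have hXk : X ∈ LinearMap.ker (μ : Bil n) := LinearMap.mem_ker.2 (LinearMap.ext hX)
        rw [← heq] at hXk
        have := congrArg (fun F => F Y) (LinearMap.mem_ker.1 hXk)
        have hz0 : z = 0 := by simpa [wedge_apply, hX, hfX, hgY, hfY, ht] using this
        exact hzY (hz0 ▸ zero_mem _)
    have := Submodule.finrank_lt_finrank_of_lt hlt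
    have heq := finrank_ker_act h ((μ : Bil n) + t • wedge f g z)
    rw [← hh] at heq
    omega

theorem exists_degeneration {μ : lieVariety n} (hn : 3 ≤ n)
    (hnil : LieRing.IsNilpotent (LieAlg μ))
    (hder : HasNontrivialSemisimpleDerivation (LieAlg μ)) :
    ∃ ψ : Bil n, IsLinearDeformation (μ : Bil n) ψ ∧
      ∀ t : ℂ, t ≠ 0 → DegeneratesTo ((μ : Bil n) + t • ψ) (μ : Bil n) := by
  obtain ⟨δ, hδ0, hδss⟩ := hder
  let D : Module.End ℂ (Fin n → ℂ) := (δ : LieAlg μ →ₗ[ℂ] LieAlg μ)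
  have hss : D.IsSemisimple := hδss
  have hD0 : D ≠ 0 := fun h => hδ0 (LieDerivation.ext fun x => congrArg (fun F => F x) h)
  have hD : ∀ x y, D ((μ : Bil n) x y) = (μ : Bil n) (D x) y + (μ : Bil n) x (D y) := by
    intro x y
    have := δ.apply_lie_eq_sub x y
    rw [μ.2.skew (D x) y, neg_add_eq_sub]
    exact this
  obtain ⟨X, l, f, hl, hX, hfX, hfD, hf⟩ := exists_eigenfunctional hnil hD hss hD0
  by_cases hne : ∃ x, f x = 0 ∧ D x ≠ 0
  · exact ⟨wedgeEnd f D, isLinearDeformation_wedgeEnd μ.2 hD hfD hf, fun t ht =>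
      ⟨mem_zariskiClosure_orbit_of_rescaling
        (fun s hs => exists_automorphism_rescaling_wedgeEnd hD hss hl hfD hs) ht,
        notMem_orbit_add_wedgeEnd hnil hD hss hl hX hfX hfD hf hne ht⟩⟩
  -- Here `D` vanishes on `ker f`. Applying `D` to `[X, y']` with `y'` in `ker f` gives both `0` and
  -- `l [X, y']`, so `X` is central.
  · push Not at hne
    refine exists_degeneration_of_central hnil hn hfX hf fun y => ?_
    have h₁ : D (y - f y • X) = 0 := hne _ (by simp [hfX])
    have h₂ := hD X (y - f y • X)
    rw [hne _ (hf _ _), h₁, hX] at h₂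
    simpa [hl, μ.2.alternating] using h₂.symm

/-! ### Diagonal operators on `ℓ²` -/

section Diagonal

variable {ι : Type*}

theorem memlp_two_iff {f : ι → ℂ} : Memℓp f 2 ↔ Summable fun i => ‖f i‖ ^ 2 := by
  rw [memℓp_gen_iff (by norm_num)]
  norm_num

/-- The diagonal operator on `ℓ²` with real weights `w`, on its maximal domain. -/
def diagOp (w : ι → ℝ) : lp (fun _ : ι => ℂ) 2 →ₗ.[ℂ] lp (fun _ : ι => ℂ) 2 where
  domain :=
    { carrier := {f | Memℓp (fun i => (w i : ℂ) * f i) 2}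
      zero_mem' := by
        change Memℓp (fun i => (w i : ℂ) * 0) 2
        simp only [mul_zero]
        exact zero_memℓp
      add_mem' := fun {f g} hf hg => by
        change Memℓp (fun i => (w i : ℂ) * (f i + g i)) 2
        simp only [mul_add]
        exact Memℓp.add hf hg
      smul_mem' := fun c f hf => by
        change Memℓp (fun i => (w i : ℂ) * (c * f i)) 2
        simp only [mul_left_comm _ c]
        exact Memℓp.const_smul hf c }
  toFun :=
    { toFun := fun f => ⟨fun i => (w i : ℂ) * f.1 i, f.2⟩
      map_add' := fun f g => by
        ext i
        exact mul_add _ _ _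
      map_smul' := fun c f => by
        ext i
        simp [mul_left_comm] }

theorem mem_diagOp_domain {w : ι → ℝ} {f : lp (fun _ : ι => ℂ) 2} :
    f ∈ (diagOp w).domain ↔ Memℓp (fun i => (w i : ℂ) * f i) 2 := Iff.rfl

theorem diagOp_apply {w : ι → ℝ} (f : (diagOp w).domain) (i : ι) :
    diagOp w f i = (w i : ℂ) * (f : lp (fun _ : ι => ℂ) 2) i := rfl

theorem single_mem_diagOp_domain [DecidableEq ι] (w : ι → ℝ) (k : ι) (a : ℂ) :
    lp.single 2 k a ∈ (diagOp w).domain := by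
  have : (fun i => (w i : ℂ) * (lp.single (E := fun _ : ι => ℂ) 2 k a) i) =
      lp.single (E := fun _ : ι => ℂ) 2 k ((w k : ℂ) * a) := by
    ext i
    by_cases h : i = k
    · subst h; simp
    · simp [h]
  rw [mem_diagOp_domain, this]
  exact lp.memℓp _

theorem dense_diagOp_domain (w : ι → ℝ) :
    Dense ((diagOp w).domain : Set (lp (fun _ : ι => ℂ) 2)) := by
  classical
  rw [Submodule.dense_iff_topologicalClosure_eq_top,
    Submodule.topologicalClosure_eq_top_iff, Submodule.eq_bot_iff]
  intro f hf
  ext k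
  have := (Submodule.mem_orthogonal _ _).1 hf _ (single_mem_diagOp_domain w k 1)
  rw [lp.inner_single_left] at this
  simpa using this

/-- Testing the adjoint against basis vectors shows that it too multiplies coordinates by `w`; since
the domain is maximal, nothing is added to it. -/
theorem isSelfAdjoint_diagOp (w : ι → ℝ) : IsSelfAdjoint (diagOp w) := by
  classical
  rw [LinearPMap.isSelfAdjoint_def]
  have hformal : (diagOp w).IsFormalAdjoint (diagOp w) := by
    intro f g
    rw [lp.inner_eq_tsum, lp.inner_eq_tsum]
    refine tsum_congr fun i => ?_
    simp only [diagOp_apply, RCLike.inner_apply, map_mul, Complex.conj_ofReal]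
    ring
  refine (LinearPMap.eq_of_le_of_domain_eq (hformal.le_adjoint (dense_diagOp_domain w))
    (le_antisymm (hformal.le_adjoint (dense_diagOp_domain w)).1 fun y hy => ?_)).symm
  rw [mem_diagOp_domain]
  have h := LinearPMap.adjoint_isFormalAdjoint (dense_diagOp_domain w) ⟨y, hy⟩
  convert lp.memℓp ((diagOp w).adjoint ⟨y, hy⟩) using 1
  ext k
  have hk := h ⟨lp.single 2 k 1, single_mem_diagOp_domain w k 1⟩
  have hd : diagOp w ⟨lp.single 2 k 1, single_mem_diagOp_domain w k 1⟩ =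
      lp.single 2 k (w k : ℂ) := by
    ext i
    rw [diagOp_apply]
    by_cases hik : i = k
    · subst hik; simp
    · simp [hik]
  rw [hd, lp.inner_single_right, lp.inner_single_right] at hk
  have := congrArg (starRingEnd ℂ) hk
  simpa using this.symm

/-- Because the weights are at least one, square summability against `w ^ (k + 1)` already implies
it against `w`, so the intermediate domain conditions are automatic. -/
theorem mem_powDomain_diagOp {w : ι → ℝ} (hw : ∀ i, 1 ≤ w i) (k : ℕ)
    (f : lp (fun _ : ι => ℂ) 2) :
    f ∈ powDomain (diagOp w) k ↔ Memℓp (fun i => (w i : ℂ) ^ k * f i) 2 := by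
  induction k generalizing f with
  | zero => simpa [powDomain] using lp.memℓp f
  | succ k ih =>
    have hpow : ∀ g : (diagOp w).domain, diagOp w g ∈ powDomain (diagOp w) k ↔
        Memℓp (fun i => (w i : ℂ) ^ (k + 1) * (g : lp (fun _ : ι => ℂ) 2) i) 2 := by
      intro g
      rw [ih]
      simp only [diagOp_apply, pow_succ, mul_assoc]
    rw [powDomain, Submodule.mem_map]
    constructor
    · rintro ⟨g, hg, rfl⟩
      exact (hpow g).1 hg
    · intro hf
      have hdom : f ∈ (diagOp w).domain := by
        rw [memlp_two_iff] at hf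
        rw [mem_diagOp_domain, memlp_two_iff]
        refine hf.of_nonneg_of_le (fun i => by positivity) fun i => ?_
        have h1 : w i ≤ w i ^ (k + 1) := le_self_pow₀ (hw i) (by omega)
        have h0 : 0 ≤ w i := zero_le_one.trans (hw i)
        simp only [norm_mul, norm_pow, Complex.norm_real, Real.norm_eq_abs, abs_of_nonneg h0]
        gcongr
      exact ⟨⟨f, hdom⟩, (hpow ⟨f, hdom⟩).2 hf, rfl⟩

/-- Square summability against all powers of the weights `w`. -/
def RapidDecay (w : ι → ℝ) (f : ι → ℂ) : Prop :=
  ∀ k : ℕ, Summable fun i => ‖(w i : ℂ) ^ k * f i‖ ^ 2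

theorem mem_smoothDomain_diagOp {w : ι → ℝ} (hw : ∀ i, 1 ≤ w i) (f : lp (fun _ : ι => ℂ) 2) :
    f ∈ smoothDomain (diagOp w) ↔ RapidDecay w f := by
  simp only [smoothDomain, Submodule.mem_iInf, mem_powDomain_diagOp hw, memlp_two_iff, RapidDecay]

theorem RapidDecay.memlp {w : ι → ℝ} {f : ι → ℂ} (hf : RapidDecay w f) : Memℓp f 2 := by
  rw [memlp_two_iff]
  simpa using hf 0

theorem rapidDecay_single [DecidableEq ι] (w : ι → ℝ) (k : ι) (a : ℂ) :
    RapidDecay w (Pi.single k a) := fun m =>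
  summable_of_ne_finset_zero (s := {k}) fun i hi => by
    rw [Finset.mem_singleton] at hi
    simp [hi]

/-- The operator on the smooth domain of a diagonal operator induced by a linear map on sequences
preserving rapid decay. -/
def smoothEnd {w : ι → ℝ} (hw : ∀ i, 1 ≤ w i) (T : (ι → ℂ) →ₗ[ℂ] (ι → ℂ))
    (hT : ∀ f, RapidDecay w f → RapidDecay w (T f)) :
    Module.End ℂ (smoothDomain (diagOp w)) where
  toFun f := ⟨⟨T f.1, (hT _ ((mem_smoothDomain_diagOp hw _).1 f.2)).memlp⟩,
    (mem_smoothDomain_diagOp hw _).2 (hT _ ((mem_smoothDomain_diagOp hw _).1 f.2))⟩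
  map_add' f g := by
    refine Subtype.ext (Subtype.ext ?_)
    exact T.map_add _ _
  map_smul' c f := by
    refine Subtype.ext (Subtype.ext ?_)
    exact T.map_smul _ _

theorem smoothDomain_ext {w : ι → ℝ} {f g : smoothDomain (diagOp w)}
    (h : ((f : lp (fun _ : ι => ℂ) 2) : ι → ℂ) = (g : lp (fun _ : ι => ℂ) 2)) : f = g :=
  Subtype.ext (Subtype.ext h)

end Diagonal

theorem separableSpace_l2 (ι : Type*) [Countable ι] :
    TopologicalSpace.SeparableSpace (lp (fun _ : ι => ℂ) 2) := by
  have b : HilbertBasis ι ℂ (lp (fun _ : ι => ℂ) 2) := default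
  have h := (Set.countable_range b).isSeparable.span (R := ℂ)
  have h' := h.closure
  rw [← Submodule.topologicalClosure_coe, b.dense_span, Submodule.top_coe] at h'
  exact TopologicalSpace.isSeparable_univ_iff.1 h'

/-! ### Ladder operators on sequences -/

section Ladder

variable {N : ℕ}

/-- The multi-index with its `i`-th entry increased by one. -/
def bump (i : Fin N) (k : Fin N → ℕ) : Fin N → ℕ := k + Pi.single i 1

/-- The multi-index with its `i`-th entry decreased by one, if positive. -/
def drop (i : Fin N) (k : Fin N → ℕ) : Fin N → ℕ := k - Pi.single i 1

theorem bump_self (i : Fin N) (k : Fin N → ℕ) : bump i k i = k i + 1 := by simp [bump]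

theorem bump_ne {i j : Fin N} (h : j ≠ i) (k : Fin N → ℕ) : bump i k j = k j := by simp [bump, h]

theorem drop_self (i : Fin N) (k : Fin N → ℕ) : drop i k i = k i - 1 := by simp [drop]

theorem drop_ne {i j : Fin N} (h : j ≠ i) (k : Fin N → ℕ) : drop i k j = k j := by simp [drop, h]

theorem drop_bump (i : Fin N) (k : Fin N → ℕ) : drop i (bump i k) = k := by
  simp [drop, bump]

theorem bump_drop {i : Fin N} {k : Fin N → ℕ} (h : k i ≠ 0) : bump i (drop i k) = k := by
  ext j
  by_cases hj : j = i
  · subst hj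
    rw [bump_self, drop_self]
    omega
  · rw [bump_ne hj, drop_ne hj]

theorem bump_injective (i : Fin N) : Function.Injective (bump i) := fun k l h => by
  rw [← drop_bump i k, h, drop_bump]

theorem bump_comm (i j : Fin N) (k : Fin N → ℕ) : bump i (bump j k) = bump j (bump i k) := by
  simp only [bump]
  abel

theorem drop_comm (i j : Fin N) (k : Fin N → ℕ) : drop i (drop j k) = drop j (drop i k) := by
  ext l
  simp only [drop, Pi.sub_apply]
  omega

theorem drop_bump_comm {i j : Fin N} (h : i ≠ j) (k : Fin N → ℕ) :
    drop j (bump i k) = bump i (drop j k) := by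
  ext l
  by_cases hi : l = i
  · subst hi
    rw [drop_ne h, bump_self, bump_self, drop_ne h]
  · by_cases hj : l = j
    · subst hj
      rw [drop_self, bump_ne hi, bump_ne hi, drop_self]
    · rw [drop_ne hj, bump_ne hi, bump_ne hi, drop_ne hj]

/-- The total degree plus one. -/
def weight (k : Fin N → ℕ) : ℝ := 1 + ∑ i, (k i : ℝ)

theorem one_le_weight (k : Fin N → ℕ) : 1 ≤ weight k := by
  have : 0 ≤ ∑ i, (k i : ℝ) := Finset.sum_nonneg fun i _ => Nat.cast_nonneg _
  rw [weight]
  linarith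

theorem add_one_le_weight (i : Fin N) (k : Fin N → ℕ) : (k i : ℝ) + 1 ≤ weight k := by
  have : (k i : ℝ) ≤ ∑ i, (k i : ℝ) :=
    Finset.single_le_sum (f := fun i => (k i : ℝ)) (fun i _ => Nat.cast_nonneg _)
      (Finset.mem_univ i)
  rw [weight]
  linarith

theorem weight_bump (i : Fin N) (k : Fin N → ℕ) : weight (bump i k) = weight k + 1 := by
  have : ∑ j, ((Pi.single i 1 : Fin N → ℕ) j : ℝ) = 1 := by
    rw [Finset.sum_eq_single i] <;> simp +contextual
  simp only [weight, bump, Pi.add_apply, Nat.cast_add, Finset.sum_add_distrib, this]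
  ring

/-- The annihilation operator in the `i`-th variable. -/
def lower (i : Fin N) : ((Fin N → ℕ) → ℂ) →ₗ[ℂ] ((Fin N → ℕ) → ℂ) where
  toFun f k := (Real.sqrt (k i + 1) : ℂ) * f (bump i k)
  map_add' f g := by
    ext k
    simp [mul_add]
  map_smul' c f := by
    ext k
    simp [mul_left_comm]

/-- The creation operator in the `i`-th variable. -/
def raise (i : Fin N) : ((Fin N → ℕ) → ℂ) →ₗ[ℂ] ((Fin N → ℕ) → ℂ) where
  toFun f k := (Real.sqrt (k i) : ℂ) * f (drop i k)
  map_add' f g := by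
    ext k
    simp [mul_add]
  map_smul' c f := by
    ext k
    simp [mul_left_comm]

theorem lower_apply (i : Fin N) (f : (Fin N → ℕ) → ℂ) (k : Fin N → ℕ) :
    lower i f k = (Real.sqrt (k i + 1) : ℂ) * f (bump i k) := rfl

theorem raise_apply (i : Fin N) (f : (Fin N → ℕ) → ℂ) (k : Fin N → ℕ) :
    raise i f k = (Real.sqrt (k i) : ℂ) * f (drop i k) := rfl

theorem raise_apply_bump (i : Fin N) (f : (Fin N → ℕ) → ℂ) (k : Fin N → ℕ) :
    raise i f (bump i k) = (Real.sqrt (k i + 1) : ℂ) * f k := by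
  rw [raise_apply, drop_bump, bump_self]
  push_cast
  rfl

theorem raise_apply_of_notMem_range (i : Fin N) (f : (Fin N → ℕ) → ℂ) {k : Fin N → ℕ}
    (hk : k ∉ Set.range (bump i)) : raise i f k = 0 := by
  have : k i = 0 := by
    by_contra h
    exact hk ⟨drop i k, bump_drop h⟩
  simp [raise_apply, this]

theorem ofReal_sqrt_mul_self {x : ℝ} (hx : 0 ≤ x) :
    (Real.sqrt x : ℂ) * (Real.sqrt x : ℂ) = x := by
  rw [← Complex.ofReal_mul, Real.mul_self_sqrt hx]

theorem lower_raise_self (i : Fin N) (f : (Fin N → ℕ) → ℂ) (k : Fin N → ℕ) :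
    lower i (raise i f) k = (k i + 1) * f k := by
  rw [lower_apply, raise_apply_bump, ← mul_assoc, ofReal_sqrt_mul_self (by positivity)]
  push_cast
  rfl

theorem raise_lower_self (i : Fin N) (f : (Fin N → ℕ) → ℂ) (k : Fin N → ℕ) :
    raise i (lower i f) k = k i * f k := by
  by_cases h : k i = 0
  · simp [raise_apply, h]
  · obtain ⟨l, rfl⟩ : ∃ l, bump i l = k := ⟨drop i k, bump_drop h⟩
    rw [raise_apply_bump, lower_apply, ← mul_assoc, ofReal_sqrt_mul_self (by positivity),
      bump_self]
    push_cast
    rfl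

theorem lower_raise_comm {i j : Fin N} (h : i ≠ j) (f : (Fin N → ℕ) → ℂ) :
    lower i (raise j f) = raise j (lower i f) := by
  ext k
  rw [lower_apply, raise_apply, raise_apply, lower_apply, drop_bump_comm h, bump_ne h.symm,
    drop_ne h]
  ring

theorem lower_lower_comm (i j : Fin N) (f : (Fin N → ℕ) → ℂ) :
    lower i (lower j f) = lower j (lower i f) := by
  by_cases h : i = j
  · rw [h]
  ext k
  simp only [lower_apply, bump_ne h, bump_ne (Ne.symm h), bump_comm i j]
  ring

theorem raise_raise_comm (i j : Fin N) (f : (Fin N → ℕ) → ℂ) :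
    raise i (raise j f) = raise j (raise i f) := by
  by_cases h : i = j
  · rw [h]
  ext k
  simp only [raise_apply, drop_ne h, drop_ne (Ne.symm h), drop_comm i j]
  ring

theorem norm_sq_weight_mul (k : Fin N → ℕ) (p : ℕ) {x : ℝ} (hx : 0 ≤ x) (a : ℂ) :
    ‖(weight k : ℂ) ^ p * ((Real.sqrt x : ℂ) * a)‖ ^ 2 =
      weight k ^ (2 * p) * x * ‖a‖ ^ 2 := by
  have h0 : 0 ≤ weight k := zero_le_one.trans (one_le_weight k)
  simp only [norm_mul, norm_pow, Complex.norm_real, Real.norm_eq_abs, abs_of_nonneg h0,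
    abs_of_nonneg (Real.sqrt_nonneg x), mul_pow, Real.sq_sqrt hx]
  ring

theorem norm_sq_weight_mul' (k : Fin N → ℕ) (p : ℕ) (a : ℂ) :
    ‖(weight k : ℂ) ^ p * a‖ ^ 2 = weight k ^ (2 * p) * ‖a‖ ^ 2 := by
  simpa using norm_sq_weight_mul k p zero_le_one a

theorem rapidDecay_lower (i : Fin N) {f : (Fin N → ℕ) → ℂ} (hf : RapidDecay weight f) :
    RapidDecay weight (lower i f) := by
  intro p
  refine ((hf (p + 1)).comp_injective (bump_injective i)).of_nonneg_of_le
    (fun k => by positivity) fun k => ?_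
  have h1 := one_le_weight k
  have h2 := add_one_le_weight i k
  rw [Function.comp_apply, lower_apply, norm_sq_weight_mul _ _ (by positivity),
    norm_sq_weight_mul', weight_bump]
  have : weight k ^ (2 * p) * (k i + 1) ≤ (weight k + 1) ^ (2 * (p + 1)) := by
    calc weight k ^ (2 * p) * (k i + 1) ≤ (weight k + 1) ^ (2 * p) * (weight k + 1) ^ 2 := by
          gcongr
          · linarith
          · nlinarith
      _ = _ := by ring
  gcongr

/-- After reindexing along `bump i`, the weight grows to `weight k + 1 ≤ 2 * weight k`, whence the
constant `2 ^ (2 * p)`; the square root costs one further power of the weight. -/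
theorem rapidDecay_raise (i : Fin N) {f : (Fin N → ℕ) → ℂ} (hf : RapidDecay weight f) :
    RapidDecay weight (raise i f) := by
  intro p
  rw [← (bump_injective i).summable_iff fun k hk => by
    rw [raise_apply_of_notMem_range i f hk]; simp]
  refine ((hf (p + 1)).mul_left (2 ^ (2 * p))).of_nonneg_of_le
    (fun k => by simp only [Function.comp_apply]; positivity) fun k => ?_
  have h1 := one_le_weight k
  have h2 := add_one_le_weight i k
  rw [Function.comp_apply, raise_apply_bump, norm_sq_weight_mul _ _ (by positivity),
    norm_sq_weight_mul', weight_bump, ← mul_assoc]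
  have : (weight k + 1) ^ (2 * p) * (k i + 1) ≤ 2 ^ (2 * p) * weight k ^ (2 * (p + 1)) := by
    calc (weight k + 1) ^ (2 * p) * (k i + 1) ≤ (2 * weight k) ^ (2 * p) * weight k ^ 2 := by
          gcongr
          · linarith
          · nlinarith
      _ = _ := by ring
  gcongr

/-- Both sums agree term by term along `bump i`, and the right-hand one is supported on its range.
-/
theorem tsum_lower_eq_tsum_raise (i : Fin N) (f g : (Fin N → ℕ) → ℂ) :
    ∑' k, inner ℂ (lower i f k) (g k) = ∑' k, inner ℂ (f k) (raise i g k) := by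
  rw [← (bump_injective i).tsum_eq (f := fun k => inner ℂ (f k) (raise i g k))]
  · refine tsum_congr fun k => ?_
    rw [raise_apply_bump, lower_apply]
    simp only [RCLike.inner_apply, map_mul, Complex.conj_ofReal]
    ring
  · intro k hk
    by_contra h
    rw [Function.mem_support, raise_apply_of_notMem_range i g h, inner_zero_right] at hk
    exact hk rfl

theorem raise_single (i : Fin N) (k : Fin N → ℕ) :
    raise i (Pi.single k 1) = (Real.sqrt (k i + 1) : ℂ) • Pi.single (bump i k) 1 := by
  ext l
  by_cases h : l ∈ Set.range (bump i)
  · obtain ⟨m, rfl⟩ := h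
    rw [raise_apply_bump, Pi.smul_apply, smul_eq_mul]
    by_cases hm : m = k
    · subst hm; simp
    · simp [hm, (bump_injective i).ne hm]
  · rw [raise_apply_of_notMem_range i _ h, Pi.smul_apply,
      Pi.single_eq_of_ne (fun h' => h ⟨k, h'.symm⟩), smul_zero]

theorem lower_single_zero (i : Fin N) : lower i (Pi.single 0 1) = 0 := by
  ext k
  have : bump i k ≠ 0 := fun h => by
    have := congrFun h i
    simp [bump_self] at this
  simp [lower_apply, this]

/-! ### Bosons -/

/-- The number operator plus one. -/
abbrev numberOp (N : ℕ) :
    lp (fun _ : Fin N → ℕ => ℂ) 2 →ₗ.[ℂ] lp (fun _ : Fin N → ℕ => ℂ) 2 :=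
  diagOp weight

/-- The annihilation operators on the smooth domain of the number operator. -/
def annihilation (i : Fin N) : Module.End ℂ (smoothDomain (numberOp N)) :=
  smoothEnd one_le_weight (lower i) fun _ => rapidDecay_lower i

/-- The creation operators on the smooth domain of the number operator. -/
def creation (i : Fin N) : Module.End ℂ (smoothDomain (numberOp N)) :=
  smoothEnd one_le_weight (raise i) fun _ => rapidDecay_raise i

/-- The standard basis vectors, in the smooth domain of the number operator. -/
def fockVector (k : Fin N → ℕ) : smoothDomain (numberOp N) :=
  ⟨lp.single 2 k 1, (mem_smoothDomain_diagOp one_le_weight _).2 (rapidDecay_single _ k 1)⟩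

theorem fockVector_ne_zero (k : Fin N → ℕ) : fockVector k ≠ 0 := fun h => by
  have : lp.single (E := fun _ : Fin N → ℕ => ℂ) 2 k 1 k = 0 := by
    have := congrArg (fun f : smoothDomain (numberOp N) =>
      (f : lp (fun _ : Fin N → ℕ => ℂ) 2) k) h
    exact this
  simp at this

theorem creation_fockVector (i : Fin N) (k : Fin N → ℕ) :
    creation i (fockVector k) = (Real.sqrt (k i + 1) : ℂ) • fockVector (bump i k) :=
  smoothDomain_ext (raise_single i k)

theorem creation_pow_fockVector (i : Fin N) {k : Fin N → ℕ} (hk : k i = 0) (m : ℕ) :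
    (creation i ^ m) (fockVector k) =
      (Real.sqrt (m.factorial : ℝ) : ℂ) • fockVector (Pi.single i m + k) := by
  induction m with
  | zero => simp
  | succ m ih =>
    have hb : bump i (Pi.single i m + k) = Pi.single i (m + 1) + k := by
      rw [bump, Pi.single_add, add_right_comm]
    rw [pow_succ', Module.End.mul_apply, ih, map_smul, creation_fockVector, hb, smul_smul,
      ← Complex.ofReal_mul, ← Real.sqrt_mul (by positivity)]
    congr 3
    simp [hk, Nat.factorial_succ]
    ring

theorem list_prod_creation_pow_fockVector (k : Fin N → ℕ) (l : List (Fin N)) (hl : l.Nodup) :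
    (l.map fun i => creation i ^ k i).prod (fockVector 0) =
      (l.map fun i => (Real.sqrt ((k i).factorial : ℝ) : ℂ)).prod •
        fockVector (l.map fun i => Pi.single i (k i)).sum := by
  induction l with
  | nil => simp
  | cons i l ih =>
    rw [List.nodup_cons] at hl
    have hz : (l.map fun i => Pi.single (M := fun _ => ℕ) i (k i)).sum i = 0 := by
      rw [Pi.list_sum_apply]
      refine List.sum_eq_zero fun x hx => ?_
      simp only [List.mem_map] at hx
      obtain ⟨_, ⟨j, hj, rfl⟩, rfl⟩ := hx
      have hij : i ≠ j := by
        rintro rfl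
        exact hl.1 hj
      simp [hij]
    simp only [List.map_cons, List.prod_cons, List.sum_cons, Module.End.mul_apply]
    rw [ih hl.2, map_smul, creation_pow_fockVector i hz, smul_smul, mul_comm]

theorem not_bounded_numberOp (hN : 0 < N) :
    ¬ ∃ C : ℝ, ∀ f : (numberOp N).domain, ‖numberOp N f‖ ≤ C * ‖f‖ := by
  rintro ⟨C, hC⟩
  obtain ⟨m, hm⟩ := exists_nat_gt C
  let k : Fin N → ℕ := Pi.single ⟨0, hN⟩ m
  have h := hC ⟨lp.single 2 k 1, single_mem_diagOp_domain _ k 1⟩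
  have hd : numberOp N ⟨lp.single 2 k 1, single_mem_diagOp_domain _ k 1⟩ =
      lp.single 2 k (weight k : ℂ) := by
    ext i
    rw [diagOp_apply]
    by_cases hik : i = k
    · subst hik; simp
    · simp [hik]
  have hw := add_one_le_weight ⟨0, hN⟩ k
  have hk : k ⟨0, hN⟩ = m := by simp [k]
  rw [hk] at hw
  rw [hd, lp.norm_single (by norm_num), Submodule.coe_norm, lp.norm_single (by norm_num)] at h
  simp only [Complex.norm_real, Real.norm_eq_abs, norm_one, mul_one] at h
  have := le_abs_self (weight k)
  linarith

/-- The bosonic ladder operators in `N ≥ 1` variables. -/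
def bosons (hN : 0 < N) : Pseudobosons N (lp (fun _ : Fin N → ℕ => ℂ) 2) where
  N₀ := numberOp N
  selfAdjoint := isSelfAdjoint_diagOp _
  unbounded := not_bounded_numberOp hN
  A := annihilation
  B := creation
  Ad := creation
  Bd := annihilation
  dagger_A i f g := tsum_lower_eq_tsum_raise i _ _
  dagger_B i f g := by
    rw [← inner_conj_symm, ← inner_conj_symm (f : lp (fun _ : Fin N → ℕ => ℂ) 2)]
    exact congrArg _ (tsum_lower_eq_tsum_raise i _ _).symm
  ccr i f := smoothDomain_ext <| funext fun k => by
    change lower i (raise i _) k - raise i (lower i _) k = _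
    rw [lower_raise_self, raise_lower_self]
    ring
  comm_AB i j h := LinearMap.ext fun f => smoothDomain_ext (lower_raise_comm h _)
  comm_AA i j := LinearMap.ext fun f => smoothDomain_ext (lower_lower_comm i j _)
  comm_BB i j := LinearMap.ext fun f => smoothDomain_ext (raise_raise_comm i j _)
  φ₀ := fockVector 0
  φ₀_ne := fockVector_ne_zero 0
  A_φ₀ i := smoothDomain_ext (lower_single_zero i)
  Ψ₀ := fockVector 0
  Ψ₀_ne := fockVector_ne_zero 0
  Bd_Ψ₀ i := smoothDomain_ext (lower_single_zero i)
  basis := by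
    let b : HilbertBasis (Fin N → ℕ) ℂ (lp (fun _ : Fin N → ℕ => ℂ) 2) :=
      HilbertBasis.ofRepr (LinearIsometryEquiv.refl ℂ _)
    refine ⟨b.toUnconditionalSchauderBasis, fun k => ?_⟩
    have hb : b k = lp.single 2 k 1 := (b.repr_symm_single k).symm
    rw [HilbertBasis.toUnconditionalSchauderBasis_basis, hb, List.ofFn_eq_map,
      list_prod_creation_pow_fockVector k _ (List.nodup_finRange N), ← List.ofFn_eq_map,
      ← List.ofFn_eq_map, List.prod_ofFn, List.sum_ofFn, Finset.univ_sum_single, smul_smul,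
      inv_mul_cancel₀, one_smul]
    · rfl
    · refine Finset.prod_ne_zero_iff.2 fun i _ => ?_
      rw [Complex.ofReal_ne_zero]
      exact (Real.sqrt_pos.2 (by exact_mod_cast Nat.factorial_pos _)).ne'

end Ladder

/-! ### Heisenberg algebras inside Weyl algebras -/

attribute [local instance] LieRing.ofAssociativeRing

section Weyl

variable {E : Type*} [Ring E] [Algebra ℂ E]

/-- Bracketing with `a` is a derivation that sends `b` to `1`, so it acts as `d/db`. -/
theorem lie_aeval_eq_aeval_derivative {a b : E} (h : ⁅a, b⁆ = 1) (p : Polynomial ℂ) :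
    ⁅a, Polynomial.aeval b p⁆ = Polynomial.aeval b p.derivative := by
  have hpow : ∀ k : ℕ, ⁅a, b ^ k⁆ = (k : E) * b ^ (k - 1) := by
    intro k
    induction k with
    | zero => simp [Ring.lie_def]
    | succ k ih =>
      have : ⁅a, b ^ (k + 1)⁆ = ⁅a, b ^ k⁆ * b + b ^ k * ⁅a, b⁆ := by
        simp only [Ring.lie_def, pow_succ]
        noncomm_ring
      rw [this, ih, h, mul_assoc, mul_one]
      cases k with
      | zero => simp
      | succ k =>
        rw [Nat.add_sub_cancel, Nat.add_sub_cancel, ← pow_succ]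
        push_cast
        noncomm_ring
  induction p using Polynomial.induction_on' with
  | add p q hp hq => simp only [map_add, lie_add, hp, hq]
  | monomial k c =>
    rw [Polynomial.aeval_monomial, Polynomial.derivative_monomial, Polynomial.aeval_monomial,
      ← Algebra.smul_def, lie_smul, hpow, map_mul, map_natCast, mul_assoc, ← Algebra.smul_def]

/-- The canonical commutation relation makes `b` transcendental: a relation can be differentiated,
which lowers its degree until only a constant is left. -/
theorem eq_zero_of_aeval_eq_zero [Nontrivial E] {a b : E} (h : ⁅a, b⁆ = 1) {p : Polynomial ℂ}
    (hp : Polynomial.aeval b p = 0) : p = 0 := by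
  suffices ∀ (d : ℕ) (p : Polynomial ℂ), p.natDegree ≤ d → Polynomial.aeval b p = 0 → p = 0 from
    this _ p le_rfl hp
  intro d
  induction d with
  | zero =>
    intro p hd hp
    rw [Polynomial.eq_C_of_natDegree_le_zero hd, Polynomial.aeval_C,
      FaithfulSMul.algebraMap_eq_zero_iff] at hp
    rw [Polynomial.eq_C_of_natDegree_le_zero hd, hp, Polynomial.C_0]
  | succ d ih =>
    intro p hd hp
    have hder : p.derivative = 0 := by
      refine ih _ ?_ ?_
      · have := Polynomial.natDegree_derivative_le p
        omega
      · rw [← lie_aeval_eq_aeval_derivative h, hp, lie_zero]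
    have h0 := Polynomial.derivative_eq_zero.1 hder
    rw [Polynomial.eq_C_of_natDegree_eq_zero h0, Polynomial.aeval_C,
      FaithfulSMul.algebraMap_eq_zero_iff] at hp
    rw [Polynomial.eq_C_of_natDegree_eq_zero h0, hp, Polynomial.C_0]

theorem lie_aeval_eq_zero {a b : E} (h : ⁅a, b⁆ = 0) (p : Polynomial ℂ) :
    ⁅a, Polynomial.aeval b p⁆ = 0 := by
  induction p using Polynomial.induction_on' with
  | add p q hp hq => simp only [map_add, lie_add, hp, hq, add_zero]
  | monomial k c =>
    rw [Polynomial.aeval_monomial, ← Algebra.smul_def, lie_smul]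
    rw [← commute_iff_lie_eq] at h
    rw [(commute_iff_lie_eq.1 (h.pow_right k)), smul_zero]

end Weyl

/-! ### Faithful representations by ladder operators and polynomials -/

theorem exists_injective_polynomial_map {z : Fin n → ℂ} (hz : z ≠ 0) :
    ∃ θ : (Fin n → ℂ) →ₗ[ℂ] Polynomial ℂ, Function.Injective θ ∧ θ z = 1 := by
  obtain ⟨h, hh⟩ := Module.Projective.exists_dual_eq_one ℂ hz
  let q : (Fin n → ℂ) →ₗ[ℂ] Polynomial ℂ :=
    ∑ i : Fin n, Polynomial.monomial (i : ℕ) ∘ₗ LinearMap.proj i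
  have hq : ∀ x (i : Fin n), (q x).coeff i = x i := by
    intro x i
    simp [q, LinearMap.sum_apply, Polynomial.finsetSum_coeff, Polynomial.coeff_monomial,
      Fin.ext_iff.symm]
  -- The `z`-component becomes the constant term; the rest is encoded in degree at least one.
  let θ : (Fin n → ℂ) →ₗ[ℂ] Polynomial ℂ := Polynomial.monomial 0 ∘ₗ h +
    LinearMap.mulLeft ℂ Polynomial.X ∘ₗ q ∘ₗ (LinearMap.id - h.smulRight z)
  have hθ : ∀ x, θ x = Polynomial.C (h x) + Polynomial.X * q (x - h x • z) := fun x => rfl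
  refine ⟨θ, (injective_iff_map_eq_zero θ).2 fun x hx => ?_, ?_⟩
  · rw [hθ] at hx
    have h0 : h x = 0 := by simpa using congrArg (fun p : Polynomial ℂ => p.coeff 0) hx
    rw [h0, zero_smul, sub_zero, Polynomial.C_0, zero_add] at hx
    have hqx : q x = 0 := (mul_eq_zero.1 hx).resolve_left Polynomial.X_ne_zero
    ext i
    rw [← hq x, hqx, Polynomial.coeff_zero, Pi.zero_apply]
  · rw [hθ, hh, one_smul, sub_self, map_zero, mul_zero, add_zero, Polynomial.C_1]

/-- The representation `x ↦ ∑ᵢ (fᵢ(x) aᵢ + gᵢ(x) bᵢ) + θ(x)(c)`. -/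
def heisenbergRep {E ι : Type*} [Ring E] [Algebra ℂ E] [Fintype ι] (a b : ι → E) (c : E)
    (f g : ι → (Fin n → ℂ) →ₗ[ℂ] ℂ) (θ : (Fin n → ℂ) →ₗ[ℂ] Polynomial ℂ) :
    (Fin n → ℂ) →ₗ[ℂ] E :=
  ∑ i, ((f i).smulRight (a i) + (g i).smulRight (b i)) + (Polynomial.aeval c).toLinearMap ∘ₗ θ

section HeisenbergRep

variable {E ι : Type*} [Ring E] [Algebra ℂ E] [Fintype ι] {a b : ι → E} {c : E}
  {f g : ι → (Fin n → ℂ) →ₗ[ℂ] ℂ} {θ : (Fin n → ℂ) →ₗ[ℂ] Polynomial ℂ}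

theorem heisenbergRep_apply (x : Fin n → ℂ) : heisenbergRep a b c f g θ x =
    ∑ i, (f i x • a i + g i x • b i) + Polynomial.aeval c (θ x) := by
  simp [heisenbergRep, LinearMap.sum_apply]

variable [DecidableEq ι]

theorem lie_heisenbergRep_left (haa : ∀ i j, ⁅a i, a j⁆ = 0)
    (hab : ∀ i j, ⁅a i, b j⁆ = if i = j then 1 else 0) (hac : ∀ i, ⁅a i, c⁆ = 0)
    (i : ι) (x : Fin n → ℂ) : ⁅a i, heisenbergRep a b c f g θ x⁆ = g i x • (1 : E) := by
  simp [heisenbergRep_apply, lie_sum, haa, hab, lie_aeval_eq_zero (hac i)]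

theorem lie_heisenbergRep_right (hbb : ∀ i j, ⁅b i, b j⁆ = 0)
    (hab : ∀ i j, ⁅a i, b j⁆ = if i = j then 1 else 0) (hbc : ∀ i, ⁅b i, c⁆ = 0)
    (i : ι) (x : Fin n → ℂ) : ⁅b i, heisenbergRep a b c f g θ x⁆ = -(f i x • (1 : E)) := by
  have hba : ∀ i j, ⁅b i, a j⁆ = if j = i then -1 else 0 := fun i j => by
    rw [← lie_skew, hab]
    split_ifs <;> simp
  simp [heisenbergRep_apply, lie_sum, hbb, hba, lie_aeval_eq_zero (hbc i)]

theorem lie_heisenbergRep (haa : ∀ i j, ⁅a i, a j⁆ = 0) (hbb : ∀ i j, ⁅b i, b j⁆ = 0)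
    (hab : ∀ i j, ⁅a i, b j⁆ = if i = j then 1 else 0) (hac : ∀ i, ⁅a i, c⁆ = 0)
    (hbc : ∀ i, ⁅b i, c⁆ = 0) (x y : Fin n → ℂ) :
    ⁅heisenbergRep a b c f g θ x, heisenbergRep a b c f g θ y⁆ =
      (∑ i, (f i x * g i y - f i y * g i x)) • (1 : E) := by
  have hc : ⁅Polynomial.aeval c (θ x), heisenbergRep a b c f g θ y⁆ = 0 := by
    have hcc : ⁅Polynomial.aeval c (θ x), Polynomial.aeval c (θ y)⁆ = 0 := by
      rw [← commute_iff_lie_eq]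
      exact (Commute.all _ _).map _
    have hca : ∀ i, ⁅Polynomial.aeval c (θ x), a i⁆ = 0 := fun i => by
      rw [← lie_skew, lie_aeval_eq_zero (hac i), neg_zero]
    have hcb : ∀ i, ⁅Polynomial.aeval c (θ x), b i⁆ = 0 := fun i => by
      rw [← lie_skew, lie_aeval_eq_zero (hbc i), neg_zero]
    simp [heisenbergRep_apply y, lie_sum, hcc, hca, hcb]
  rw [heisenbergRep_apply x, add_lie, hc, add_zero, sum_lie, Finset.sum_smul]
  refine Finset.sum_congr rfl fun i _ => ?_
  rw [add_lie, smul_lie, smul_lie, lie_heisenbergRep_left haa hab hac,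
    lie_heisenbergRep_right hbb hab hbc]
  module

/-- Brackets with `b i` and `a i` recover the coordinates `f i x` and `g i x`; what remains is a
polynomial in `c`, which is transcendental. -/
theorem heisenbergRep_injective [Nontrivial E] (haa : ∀ i j, ⁅a i, a j⁆ = 0)
    (hbb : ∀ i j, ⁅b i, b j⁆ = 0)
    (hab : ∀ i j, ⁅a i, b j⁆ = if i = j then 1 else 0) (hac : ∀ i, ⁅a i, c⁆ = 0)
    (hbc : ∀ i, ⁅b i, c⁆ = 0) {d : E} (hdc : ⁅d, c⁆ = 1)
    (hθ : ∀ x, (∀ i, f i x = 0) → (∀ i, g i x = 0) → θ x = 0 → x = 0) :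
    Function.Injective (heisenbergRep a b c f g θ) := by
  rw [injective_iff_map_eq_zero]
  intro x hx
  have hf : ∀ i, f i x = 0 := fun i => by
    have := lie_heisenbergRep_right (f := f) (g := g) (θ := θ) hbb hab hbc i x
    rw [hx, lie_zero, eq_comm, neg_eq_zero, smul_eq_zero] at this
    exact this.resolve_right one_ne_zero
  have hg : ∀ i, g i x = 0 := fun i => by
    have := lie_heisenbergRep_left (f := f) (g := g) (θ := θ) haa hab hac i x
    rw [hx, lie_zero, eq_comm, smul_eq_zero] at this
    exact this.resolve_right one_ne_zero
  refine hθ x hf hg (eq_zero_of_aeval_eq_zero hdc ?_)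
  rw [heisenbergRep_apply] at hx
  simpa [hf, hg] using hx

end HeisenbergRep

theorem Pseudobosons.lie_AB {N : ℕ} {H : Type*} [NormedAddCommGroup H] [InnerProductSpace ℂ H]
    [CompleteSpace H] (P : Pseudobosons N H) (i j : Fin N) :
    ⁅P.A i, P.B j⁆ = if i = j then 1 else 0 := by
  rw [Ring.lie_def]
  split_ifs with h
  · subst h
    exact LinearMap.ext (P.ccr i)
  · rw [P.comm_AB i j h, sub_self]

theorem Pseudobosons.mem_Ldagger_of_mem_adjoin {N : ℕ} {H : Type*} [NormedAddCommGroup H]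
    [InnerProductSpace ℂ H] [CompleteSpace H] (P : Pseudobosons N H)
    {T : Module.End ℂ (smoothDomain P.N₀)}
    (hT : T ∈ Algebra.adjoin ℂ (Set.range P.A ∪ Set.range P.B)) :
    T ∈ Ldagger (smoothDomain P.N₀) := by
  refine Algebra.adjoin_le ?_ hT
  rintro _ (⟨i, rfl⟩ | ⟨i, rfl⟩)
  · exact ⟨_, P.dagger_A i⟩
  · exact ⟨_, P.dagger_B i⟩

/-- Heisenberg algebras plus abelian factors are realized by pseudobosonic operators. -/
theorem realizedByPseudobosons_sum_wedge {m : ℕ} (hm : 0 < m)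
    {f g : Fin m → (Fin n → ℂ) →ₗ[ℂ] ℂ} {a b : Fin m → Fin n → ℂ} {z : Fin n → ℂ} (hz : z ≠ 0)
    (hfz : ∀ i, f i z = 0) (hgz : ∀ i, g i z = 0)
    (hfa : ∀ i j, f i (a j) = if i = j then 1 else 0) (hfb : ∀ i j, f i (b j) = 0)
    (hga : ∀ i j, g i (a j) = 0) (hgb : ∀ i j, g i (b j) = if i = j then 1 else 0)
    (ν : lieVariety n) (hν : (ν : Bil n) = ∑ i, wedge (f i) (g i) z) :
    RealizedByPseudobosons (LieAlg ν) := by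
  -- The first `m` modes carry the Heisenberg pairs; the last one provides the creation operator
  -- whose polynomials represent the remaining directions.
  let P : Pseudobosons (m + 1) (lp (fun _ : Fin (m + 1) → ℕ => ℂ) 2) := bosons m.succ_pos
  obtain ⟨θ, hθ, hθz⟩ := exists_injective_polynomial_map hz
  -- Projection killing every `a j` and `b j` and fixing `z`, so that the `a j` and `b j` are
  -- represented by pure ladder operators.
  let π : (Fin n → ℂ) →ₗ[ℂ] (Fin n → ℂ) :=
    LinearMap.id - ∑ i, ((f i).smulRight (a i) + (g i).smulRight (b i))
  have hπ : ∀ x, π x = x - ∑ i, (f i x • a i + g i x • b i) := fun x => by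
    simp [π, LinearMap.sum_apply]
  have hπa : ∀ j, π (a j) = 0 := fun j => by simp [hπ, hfa, hga]
  have hπb : ∀ j, π (b j) = 0 := fun j => by simp [hπ, hfb, hgb]
  have hπz : π z = z := by simp [hπ, hfz, hgz]
  let R := heisenbergRep (fun i : Fin m => P.A i.castSucc) (fun i : Fin m => P.B i.castSucc)
    (P.B (Fin.last m)) f g (θ ∘ₗ π)
  have haa : ∀ i j : Fin m, ⁅P.A i.castSucc, P.A j.castSucc⁆ = 0 := fun i j => by
    rw [Ring.lie_def, P.comm_AA, sub_self]
  have hbb' : ∀ i j, ⁅P.B i, P.B j⁆ = 0 := fun i j => by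
    rw [Ring.lie_def, P.comm_BB, sub_self]
  have hab : ∀ i j : Fin m, ⁅P.A i.castSucc, P.B j.castSucc⁆ = if i = j then 1 else 0 :=
    fun i j => by
      rw [P.lie_AB]
      simp
  have hac : ∀ i : Fin m, ⁅P.A i.castSucc, P.B (Fin.last m)⁆ = 0 := fun i => by
    rw [P.lie_AB, if_neg (Fin.castSucc_lt_last i).ne]
  have hdc : ⁅P.A (Fin.last m), P.B (Fin.last m)⁆ = 1 := by
    rw [P.lie_AB, if_pos rfl]
  have hA : ∀ i, P.A i ∈ Algebra.adjoin ℂ (Set.range P.A ∪ Set.range P.B) := fun i =>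
    Algebra.subset_adjoin (Or.inl ⟨i, rfl⟩)
  have hB : ∀ i, P.B i ∈ Algebra.adjoin ℂ (Set.range P.A ∪ Set.range P.B) := fun i =>
    Algebra.subset_adjoin (Or.inr ⟨i, rfl⟩)
  have hR : ∀ x, R x ∈ Algebra.adjoin ℂ (Set.range P.A ∪ Set.range P.B) := by
    intro x
    rw [heisenbergRep_apply]
    refine add_mem (sum_mem fun i _ => add_mem (Subalgebra.smul_mem _ (hA _) _)
      (Subalgebra.smul_mem _ (hB _) _)) ?_
    exact Algebra.adjoin_mono (Set.singleton_subset_iff.2 (Or.inr ⟨Fin.last m, rfl⟩) :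
      {P.B (Fin.last m)} ⊆ Set.range P.A ∪ Set.range P.B)
      (Polynomial.aeval_mem_adjoin_singleton ℂ _)
  have : Nontrivial (Module.End ℂ (smoothDomain P.N₀)) := by
    have : Nontrivial (smoothDomain P.N₀) := ⟨P.φ₀, 0, P.φ₀_ne⟩
    infer_instance
  have hinj : Function.Injective R := by
    refine heisenbergRep_injective haa (fun i j => hbb' _ _) hab hac (fun i => hbb' _ _) hdc ?_
    intro x hf hg hx
    have : π x = 0 := (injective_iff_map_eq_zero θ).1 hθ _ hx
    rw [hπ] at this
    simpa [hf, hg] using this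
  have hlie : ∀ x y, R ((ν : Bil n) x y) = R x * R y - R y * R x := by
    intro x y
    have h := lie_heisenbergRep (f := f) (g := g) (θ := θ ∘ₗ π) haa (fun i j => hbb' _ _) hab hac
      (fun i => hbb' _ _) x y
    rw [Ring.lie_def] at h
    have hRz : R z = 1 := by
      simp [R, heisenbergRep_apply, hfz, hgz, hπz, hθz]
    refine Eq.trans ?_ h.symm
    rw [hν, LinearMap.sum_apply, LinearMap.sum_apply]
    simp only [wedge_apply]
    rw [← Finset.sum_smul, map_smul, hRz]
  let ρ : LieAlg ν →ₗ[ℂ] Ldagger (smoothDomain P.N₀) :=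
    { toFun := fun x => ⟨R x, P.mem_Ldagger_of_mem_adjoin (hR x)⟩
      map_add' := fun x y => Subtype.ext (R.map_add x y)
      map_smul' := fun c x => Subtype.ext (R.map_smul c x) }
  refine ⟨_, _, _, inferInstance, separableSpace_l2 _, m + 1, P, ρ, fun x y => ?_, fun x y h => ?_,
    fun x => ?_, Fin.castSucc ⟨0, hm⟩, a ⟨0, hm⟩, b ⟨0, hm⟩, ?_, ?_⟩
  · exact Subtype.ext (hlie x y)
  · exact hinj (congrArg Subtype.val h)
  · exact Algebra.adjoin_mono (fun T hT => Or.inl (Or.inl hT)) (hR x)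
  · change R (a ⟨0, hm⟩) = _
    simp [R, heisenbergRep_apply, hfa, hga, hπa]
  · change R (b ⟨0, hm⟩) = _
    simp [R, heisenbergRep_apply, hfb, hgb, hπb]

/-! ### Pencils through a Heisenberg bracket -/

instance (ν : lieVariety n) : Module.Finite ℂ (LieAlg ν) :=
  inferInstanceAs (Module.Finite ℂ (Fin n → ℂ))

/-- Engel's theorem. -/
theorem isNilpotent_of_bracket_bracket_eq_zero {ν : lieVariety n}
    (h : ∀ x y, (ν : Bil n) x ((ν : Bil n) x y) = 0) : LieRing.IsNilpotent (LieAlg ν) := by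
  rw [LieAlgebra.isNilpotent_iff_forall (R := ℂ)]
  intro x
  refine ⟨2, LinearMap.ext fun y => ?_⟩
  rw [pow_two]
  exact h x y

theorem exists_realized_of_wedge {m : ℕ} (hm : 0 < m) {μ : lieVariety n}
    {f g : Fin m → (Fin n → ℂ) →ₗ[ℂ] ℂ} {a b : Fin m → Fin n → ℂ} {z : Fin n → ℂ} (hz : z ≠ 0)
    (hfz : ∀ i, f i z = 0) (hgz : ∀ i, g i z = 0)
    (hfa : ∀ i j, f i (a j) = if i = j then 1 else 0) (hfb : ∀ i j, f i (b j) = 0)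
    (hga : ∀ i j, g i (a j) = 0) (hgb : ∀ i j, g i (b j) = if i = j then 1 else 0)
    (hfμ : ∀ i x y, f i ((μ : Bil n) x y) = 0) (hgμ : ∀ i x y, g i ((μ : Bil n) x y) = 0)
    (hzμ : ∀ x, (μ : Bil n) x z = 0)
    (hne : ∑ i, wedge (f i) (g i) z ∉ orbit (μ : Bil n)) :
    ∃ ν : lieVariety n, LieRing.IsNilpotent (LieAlg ν) ∧ RealizedByPseudobosons (LieAlg ν) ∧
      (ν : Bil n) ∉ orbit (μ : Bil n) ∧
      ∃ φ : Bil n, IsLinearDeformation (ν : Bil n) φ ∧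
        ∃ t : ℂ, t ≠ 0 ∧ (μ : Bil n) = (ν : Bil n) + t • φ := by
  have hL := isLieBracket_sum_wedge hfz hgz
  let ν : lieVariety n := ⟨∑ i, wedge (f i) (g i) z, hL⟩
  -- Each mixed Jacobi term applies some `f i` or `g i` to a value of `μ`, or `μ` to the central
  -- `z`, so all vanish separately.
  have hcomb : ∀ s t : ℂ, IsLieBracket (s • (μ : Bil n) + t • ∑ i, wedge (f i) (g i) z) := by
    refine μ.2.smul_add_smul hL fun x y w => ?_
    simp [LinearMap.sum_apply, wedge_apply, hfμ, hgμ, hzμ]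
  refine ⟨ν, isNilpotent_of_bracket_bracket_eq_zero fun x y => ?_,
    realizedByPseudobosons_sum_wedge hm hz hfz hgz hfa hfb hga hgb ν rfl, hne,
    -- The direction `μ - ν` and all `ν + t (μ - ν)` lie in the span of `μ` and `ν`; `t = 1` gives
    -- `μ`.
    (μ : Bil n) - ν, ⟨hL, ?_, fun t _ => ?_⟩, 1, one_ne_zero, by module⟩
  · simp [ν, LinearMap.sum_apply, wedge_apply, hfz, hgz]
  · have := hcomb 1 (-1)
    have heq : (μ : Bil n) - ν = (1 : ℂ) • (μ : Bil n) + (-1 : ℂ) • (ν : Bil n) := by module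
    rw [heq]
    exact this
  · have := hcomb t (1 - t)
    have heq : (ν : Bil n) + t • ((μ : Bil n) - ν) = t • (μ : Bil n) + (1 - t) • (ν : Bil n) := by
      module
    rw [heq]
    exact this

/-- Coordinates on the quotient by the line of `z` annihilate `z`; those of even index serve as `f`,
those of odd index as `g`. -/
theorem exists_biorthogonal_apply_eq_zero (z : Fin n → ℂ) {m : ℕ} (hm : 2 * m + 1 ≤ n) :
    ∃ (f g : Fin m → (Fin n → ℂ) →ₗ[ℂ] ℂ) (a b : Fin m → Fin n → ℂ),
      (∀ i, f i z = 0) ∧ (∀ i, g i z = 0) ∧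
      (∀ i j, f i (a j) = if i = j then 1 else 0) ∧ (∀ i j, f i (b j) = 0) ∧
      (∀ i j, g i (a j) = 0) ∧ (∀ i j, g i (b j) = if i = j then 1 else 0) := by
  let S := Submodule.span ℂ {z}
  let β := Module.finBasis ℂ ((Fin n → ℂ) ⧸ S)
  have hrank : 2 * m ≤ Module.finrank ℂ ((Fin n → ℂ) ⧸ S) := by
    have h₁ := S.finrank_quotient_add_finrank
    have h₂ : Module.finrank ℂ S ≤ 1 := (finrank_span_le_card _).trans (by simp)
    rw [Module.finrank_fin_fun] at h₁
    omega
  choose v hv using fun j => S.mkQ_surjective (β j)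
  let p : Fin m → Fin (Module.finrank ℂ ((Fin n → ℂ) ⧸ S)) := fun i => ⟨2 * i, by omega⟩
  let q : Fin m → Fin (Module.finrank ℂ ((Fin n → ℂ) ⧸ S)) := fun i => ⟨2 * i + 1, by omega⟩
  have hpp : ∀ i j, p j = p i ↔ i = j := fun i j => by simp only [p, Fin.ext_iff]; omega
  have hqq : ∀ i j, q j = q i ↔ i = j := fun i j => by simp only [q, Fin.ext_iff]; omega
  have hpq : ∀ i j, p j ≠ q i := fun i j => by simp only [p, q, ne_eq, Fin.ext_iff]; omega
  have hS : S.mkQ z = 0 := by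
    rw [Submodule.mkQ_apply, Submodule.Quotient.mk_eq_zero]
    exact Submodule.mem_span_singleton_self z
  refine ⟨fun i => β.coord (p i) ∘ₗ S.mkQ, fun i => β.coord (q i) ∘ₗ S.mkQ, fun i => v (p i),
    fun i => v (q i), fun i => ?_, fun i => ?_, fun i j => ?_, fun i j => ?_, fun i j => ?_,
    fun i j => ?_⟩
  · rw [LinearMap.comp_apply, hS, map_zero]
  · rw [LinearMap.comp_apply, hS, map_zero]
  · simp [hv, Finsupp.single_apply, hpp, -Submodule.mkQ_apply]
  · simp [hv, (hpq _ _).symm, -Submodule.mkQ_apply]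
  · simp [hv, hpq, -Submodule.mkQ_apply]
  · simp [hv, Finsupp.single_apply, hqq, -Submodule.mkQ_apply]

/-- A bracket of rank at least four with values in a line is not isomorphic to one of rank two. -/
theorem sum_wedge_notMem_orbit {m : ℕ} (hm : 2 ≤ m) {f g : Fin m → (Fin n → ℂ) →ₗ[ℂ] ℂ}
    {a b : Fin m → Fin n → ℂ} {z : Fin n → ℂ} (hz : z ≠ 0)
    (hfa : ∀ i j, f i (a j) = if i = j then 1 else 0) (hfb : ∀ i j, f i (b j) = 0)
    (hga : ∀ i j, g i (a j) = 0) (hgb : ∀ i j, g i (b j) = if i = j then 1 else 0)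
    (f' g' : (Fin n → ℂ) →ₗ[ℂ] ℂ) (z' : Fin n → ℂ) :
    ∑ i, wedge (f i) (g i) z ∉ orbit (wedge f' g' z') := by
  rintro ⟨h, hh⟩
  let T : (Fin m → ℂ) × (Fin m → ℂ) →ₗ[ℂ] ℂ × ℂ :=
    ((f'.prod g') ∘ₗ h.symm.toLinearMap) ∘ₗ
      ((Fintype.linearCombination ℂ a).coprod (Fintype.linearCombination ℂ b))
  -- Two linear conditions on a space of dimension `2 * m ≥ 4` leave a nonzero vector. It would be
  -- central for the sum, whose form is nondegenerate on the span of the `a i` and `b i`.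
  obtain ⟨⟨c, d⟩, hcd, hne⟩ := Submodule.exists_mem_ne_zero_of_ne_bot
    (T.ker_ne_bot_of_finrank_lt (by simp; omega))
  let x : Fin n → ℂ := ∑ i, c i • a i + ∑ i, d i • b i
  have hx : f' (h.symm x) = 0 ∧ g' (h.symm x) = 0 := by
    have : T (c, d) = (f' (h.symm x), g' (h.symm x)) := rfl
    rw [LinearMap.mem_ker, this] at hcd
    exact Prod.mk.inj hcd
  have hfx : ∀ i, f i x = c i := fun i => by simp [x, hfa, hfb]
  have hgx : ∀ i, g i x = d i := fun i => by simp [x, hga, hgb]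
  have hν : ∀ y, (∑ i, wedge (f i) (g i) z) x y = 0 := fun y => by
    rw [hh, act_apply, wedge_apply, hx.1, hx.2]
    simp
  have hc : c = 0 := by
    ext j
    have := hν (b j)
    simpa [LinearMap.sum_apply, wedge_apply, hfb, hgb, ← Finset.sum_smul, hz, hfx] using this
  have hd : d = 0 := by
    ext j
    have := hν (a j)
    simpa [LinearMap.sum_apply, wedge_apply, hfa, hga, ← Finset.sum_smul, hz, hgx] using this
  exact hne (by rw [hc, hd]; rfl)

theorem exists_realized_deformation {μ : lieVariety n} (hn : 5 ≤ n)
    (hnil : LieRing.IsNilpotent (LieAlg μ)) :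
    ∃ ν : lieVariety n, LieRing.IsNilpotent (LieAlg ν) ∧ RealizedByPseudobosons (LieAlg ν) ∧
      (ν : Bil n) ∉ orbit (μ : Bil n) ∧
      ∃ φ : Bil n, IsLinearDeformation (ν : Bil n) φ ∧
        ∃ t : ℂ, t ≠ 0 ∧ (μ : Bil n) = (ν : Bil n) + t • φ := by
  obtain ⟨f, a, hf, hfa⟩ := exists_dual_derived hnil (by omega)
  obtain ⟨g, b, hg, hga, hgb, hfb⟩ := exists_dual_pair hnil (by omega) hfa
  obtain ⟨z, ⟨hfz, hgz⟩, hz, hzμ⟩ := exists_central_mem hnil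
    (U := LinearMap.ker f ⊓ LinearMap.ker g) (fun x u _ => ⟨hf x u, hg x u⟩)
    (ker_inf_ker_ne_bot (by omega) f g)
  rw [SetLike.mem_coe, LinearMap.mem_ker] at hfz hgz
  by_cases horb : wedge f g z ∈ orbit (μ : Bil n)
  · obtain ⟨h, hh⟩ := horb
    -- In this case `μ` is a single wedge with values in the line of `h.symm z`. Functionals killing
    -- that line vanish on brackets, so a rank four bracket into the same line is compatible with
    -- `μ`.
    have hμ : ∀ x y, (μ : Bil n) x y = wedge (f ∘ₗ h.toLinearMap) (g ∘ₗ h.toLinearMap)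
        (h.symm z) x y := by
      intro x y
      have := congrArg (fun F : Bil n => h.symm (F (h x) (h y))) hh
      simp only [act_apply_map, LinearEquiv.symm_apply_apply] at this
      rw [← this]
      simp [wedge_apply]
    have hμ' : (μ : Bil n) = wedge (f ∘ₗ h.toLinearMap) (g ∘ₗ h.toLinearMap) (h.symm z) :=
      LinearMap.ext₂ hμ
    have hz' : h.symm z ≠ 0 := by simpa using hz
    obtain ⟨F, G, a', b', hFz, hGz, hFa, hFb, hGa, hGb⟩ :=
      exists_biorthogonal_apply_eq_zero (h.symm z) (m := 2) (by omega)
    refine exists_realized_of_wedge two_pos hz' hFz hGz hFa hFb hGa hGb ?_ ?_ ?_ ?_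
    · intro i x y
      simp [hμ, wedge_apply, hFz]
    · intro i x y
      simp [hμ, wedge_apply, hGz]
    · intro x
      simp [hμ, wedge_apply, hfz, hgz]
    · rw [hμ']
      exact sum_wedge_notMem_orbit le_rfl hz' hFa hFb hGa hGb _ _ _
  · refine exists_realized_of_wedge one_pos (f := fun _ => f) (g := fun _ => g) (a := fun _ => a)
      (b := fun _ => b) hz (fun _ => hfz) (fun _ => hgz) ?_ (fun _ _ => hfb) (fun _ _ => hga) ?_
      (fun _ => hf) (fun _ => hg) hzμ (by simpa using horb)
    · intro i j
      rw [hfa, if_pos (Subsingleton.elim i j)]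
    · intro i j
      rw [hgb, if_pos (Subsingleton.elim i j)]

end PB

end

theorem theorem4p2 (n : ℕ) (hn : 6 ≤ n) (μ : PB.lieVariety n)
    (hnil : LieRing.IsNilpotent (PB.LieAlg μ))
    (hder : PB.HasNontrivialSemisimpleDerivation (PB.LieAlg μ)) :
    (∃ ψ : PB.Bil n, PB.IsLinearDeformation (μ : PB.Bil n) ψ ∧
      ∀ t : ℂ, t ≠ 0 → PB.DegeneratesTo ((μ : PB.Bil n) + t • ψ) (μ : PB.Bil n)) ∧
    ∃ ν : PB.lieVariety n,
      LieRing.IsNilpotent (PB.LieAlg ν) ∧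
      PB.RealizedByPseudobosons (PB.LieAlg ν) ∧
      (ν : PB.Bil n) ∉ PB.orbit (μ : PB.Bil n) ∧
      ∃ φ : PB.Bil n, PB.IsLinearDeformation (ν : PB.Bil n) φ ∧
        ∃ t : ℂ, t ≠ 0 ∧ (μ : PB.Bil n) = (ν : PB.Bil n) + t • φ := by
  exact ⟨PB.exists_degeneration (by omega) hnil hder, PB.exists_realized_deformation (by omega) hnil⟩
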